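/- **Theorem (real Dritschel–McCullough theorem).** *Conventions.* Hilbert spaces are real. For a cardinal $n$ let $M_{n,m}(\mathbb R)=B(\ell^2(m),\ell^2(n))$ and $M_n=M_{n,n}(\mathbb R)$. Let $P$ be a real operator space (a subspace of some $B(H_0)$ with the induced matrix norms), let $E=P^*$ be its dual operator space, and put $M_n(E)=CB(P,M_n)$, with the point-weak* topology. Fix an infinite cardinal $\kappa$ such that $P$ has a norm-dense subset of cardinality at most $\kappa$. A *real compact nc convex set* is a graded set $K=\bigsqcup_{1\le n\le\kappa}K_n$ with $K_n\subseteq M_n(E)$ such that: (i) $\sum_i\alpha_i x_i\alpha_i^{\mathsf T}\in K_n$ for all bounded families $x_i\in K_{n_i}$ and isometries $\alpha_i\in M_{n,n_i}(\mathbb R)$ with $\sum_i\alpha_i\alpha_i^{\mathsf T}=1_n$; (ii) $\beta^{\mathsf T}x\beta\in K_m$ for all $x\in K_n$ and isometries $\beta\in M_{n,m}(\mathbb R)$; (iii) every $K_n$ is compact in the point-weak* topology. A *dilation* in $K$ of $x\in K_n$ is a $y\in K_m$ together with an isometry $\alpha\in M_{m,n}(\mathbb R)$ such that $x=\alpha^{\mathsf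 T}y\alpha$; it is *trivial* if $y$ commutes with $\alpha\alpha^{\mathsf T}$. A point of $K$ is *maximal* if all its dilations in $K$ are trivial. A *real operator system* is a unital selfadjoint subspace $V\subseteq B(H_0)$, with $M_k(V)^+=\{a\in M_k(V): a=a^*\ge 0 \text{ in } B(H_0^{(k)})\}$. A linear map $\varphi:V\to B(H)$ is *ucp* if it is unital and all its amplifications to $M_k(V)$, $k\in\mathbb N$, preserve positivity. A *dilation* of $\varphi$ is a ucp map $\psi:V\to B(L)$ together with an isometry $\alpha:H\to L$ such that $\varphi=\alpha^*\psi(\cdot)\alpha$; it is *trivial* if $\psi(V)$ commutes with $\alpha\alpha^*$. The map $\varphi$ is *maximal* if all its dilations are trivial. A ucp map $\pi:V\to B(L)$ has the *unique extension property* (UEP) if for every unital complete order embedding $j:V\to B(H_1)$, with $B$ the real $C^*$-algebra generated by $j(V)$, there is exactly one ucp map $\rho:B\to B(L)$ with $\rho\circ j=\pi$, and this $\rho$ is a $*$-homomorphism. *Statement.* 1. Every element $x$ of a real compact nc convex set $K$ has a maximal dilation in $K$. 2. For every real operator system $V$, every ucp map $\varphi:V\to B(H)$ has a dilation to a ucp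 map $\pi:V\to B(L)$ which is maximal and has the UEP. -/

import Mathlib

open scoped InnerProductSpace

universe u

noncomputable section

namespace RealNC

/-- Bounded operators on a real Hilbert space. -/
abbrev Op (H : Type*) [NormedAddCommGroup H] [InnerProductSpace ℝ H] := H →L[ℝ] H

section Common

variable {H₀ H L : Type*}
  [NormedAddCommGroup H₀] [InnerProductSpace ℝ H₀]
  [NormedAddCommGroup H] [InnerProductSpace ℝ H]
  [NormedAddCommGroup L] [InnerProductSpace ℝ L]

/-- The identification `M_k(B(H)) = B(H^(k))`: the operator `v ↦ (∑ j, a i j (v j))_i` on the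
`ℓ²`-direct sum of `k` copies of `H` determined by a matrix `a` of operators. -/
def blockOp {k : ℕ} (a : Fin k → Fin k → Op H) : Op (PiLp 2 fun _ : Fin k => H) :=
  (PiLp.continuousLinearEquiv 2 ℝ fun _ : Fin k => H).symm.toContinuousLinearMap ∘L
    ContinuousLinearMap.pi fun i =>
      ∑ j, a i j ∘L PiLp.proj (𝕜 := ℝ) 2 (fun _ : Fin k => H) j

theorem blockOp_apply {k : ℕ} (a : Fin k → Fin k → Op H) (v : PiLp 2 fun _ : Fin k => H)
    (i : Fin k) : blockOp a v i = ∑ j, a i j (v j) := by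
  simp [blockOp]

/-- Complete boundedness of a linear map `x : P → B(H)` on a (concrete) real operator space
`P ⊆ B(H₀)`: the amplifications `M_k(P) → M_k(B(H))` are uniformly bounded. -/
def IsCB (P : Submodule ℝ (Op H₀)) (x : P →ₗ[ℝ] Op H) : Prop :=
  ∃ C : ℝ, ∀ (k : ℕ) (a : Fin k → Fin k → P),
    ‖blockOp fun i j => x (a i j)‖ ≤ C * ‖blockOp fun i j => (a i j : Op H₀)‖

/-- `y` is a dilation of `x` along the isometry `α`, i.e. `x = αᵀ y α`. -/
def IsDilation [CompleteSpace H] [CompleteSpace L] {P : Submodule ℝ (Op H₀)}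
    (α : H →ₗᵢ[ℝ] L) (y : P →ₗ[ℝ] Op L) (x : P →ₗ[ℝ] Op H) : Prop :=
  ∀ f : P, x f =
    ContinuousLinearMap.adjoint α.toContinuousLinearMap ∘L y f ∘L α.toContinuousLinearMap

/-- A dilation `y` along `α` is trivial if `y` commutes with the projection `α αᵀ`. -/
def IsTrivialDilation [CompleteSpace H] [CompleteSpace L] {P : Submodule ℝ (Op H₀)}
    (α : H →ₗᵢ[ℝ] L) (y : P →ₗ[ℝ] Op L) : Prop :=
  ∀ f : P, Commute (y f)
    (α.toContinuousLinearMap ∘L ContinuousLinearMap.adjoint α.toContinuousLinearMap)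

end Common

/-! ### Real compact nc convex sets -/

/-- The real Hilbert space `ℓ²(n)` of dimension `n`, for a cardinal `n`; thus
`M_{n,m}(ℝ) = B(ℓ²(m), ℓ²(n))`. -/
abbrev Ell2 (n : Cardinal.{u}) : Type u := lp (fun _ : n.out => ℝ) 2

section NCConvex

variable {H₀ : Type*} [NormedAddCommGroup H₀] [InnerProductSpace ℝ H₀]

/-- The point-weak* topology on maps `x : P → B(H)`: the coarsest topology for which
`x ↦ ω (x f)` is continuous for all `f ∈ P` and all normal functionals
`ω(T) = ∑ k, ⟪T (ξ k), η k⟫`, where `ξ` and `η` are square summable sequences in `H`. -/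
@[reducible] def pointWeakStar (P : Submodule ℝ (Op H₀)) (H : Type*) [NormedAddCommGroup H]
    [InnerProductSpace ℝ H] : TopologicalSpace (P →ₗ[ℝ] Op H) :=
  TopologicalSpace.induced
    (fun x (t : P × lp (fun _ : ℕ => H) 2 × lp (fun _ : ℕ => H) 2) =>
      ∑' k : ℕ, ⟪x t.1 (t.2.1 k), t.2.2 k⟫_ℝ)
    Pi.topologicalSpace

/-- `K = ⨆ K_n` is a real compact nc convex set in `M(E) = ⨆ M_n(E)`, `1 ≤ n ≤ κ`. Here `E` is the
dual operator space of `P` and `M_n(E) = CB(P, B(ℓ²(n)))`. -/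
structure IsCompactNCConvex (P : Submodule ℝ (Op H₀)) (κ : Cardinal.{u})
    (K : (n : Cardinal.{u}) → Set (P →ₗ[ℝ] Op (Ell2 n))) : Prop where
  /-- the points of `K` have their size between `1` and `κ` -/
  size : ∀ n, (K n).Nonempty → 1 ≤ n ∧ n ≤ κ
  /-- `K_n ⊆ M_n(E)` -/
  cb : ∀ n, ∀ x ∈ K n, IsCB P x
  /-- closed under direct sums `x = ∑ i, α_i x_i α_iᵀ` in `M_n(E)`, where the `α_i` are isometries
  with `∑ i, α_i α_iᵀ = 1` -/
  directSum : ∀ (n : Cardinal.{u}) (ι : Type u) (m : ι → Cardinal.{u})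
    (xs : (i : ι) → P →ₗ[ℝ] Op (Ell2 (m i))) (α : (i : ι) → Ell2 (m i) →ₗᵢ[ℝ] Ell2 n)
    (x : P →ₗ[ℝ] Op (Ell2 n)), 1 ≤ n → n ≤ κ → (∀ i, xs i ∈ K (m i)) →
    (∀ h : Ell2 n, HasSum (fun i =>
      α i (ContinuousLinearMap.adjoint (α i).toContinuousLinearMap h)) h) →
    IsCB P x →
    (∀ (f : P) (h : Ell2 n), HasSum (fun i =>
      α i (xs i f (ContinuousLinearMap.adjoint (α i).toContinuousLinearMap h))) (x f h)) →
    x ∈ K n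
  /-- closed under compressions by isometries -/
  compression : ∀ (m n : Cardinal.{u}) (β : Ell2 m →ₗᵢ[ℝ] Ell2 n) (x : P →ₗ[ℝ] Op (Ell2 m))
    (y : P →ₗ[ℝ] Op (Ell2 n)), 1 ≤ m → y ∈ K n → IsDilation β y x → x ∈ K m
  /-- each level is compact in the point-weak* topology -/
  compact : ∀ n, @IsCompact _ (pointWeakStar P (Ell2 n)) (K n)

/-- A point `x ∈ K_n` is maximal if each of its dilations in `K` is trivial. -/
def IsMaximalPoint {P : Submodule ℝ (Op H₀)}
    (K : (n : Cardinal.{u}) → Set (P →ₗ[ℝ] Op (Ell2 n))) {n : Cardinal.{u}}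
    (x : P →ₗ[ℝ] Op (Ell2 n)) : Prop :=
  x ∈ K n ∧ ∀ (m : Cardinal.{u}) (y : P →ₗ[ℝ] Op (Ell2 m)) (α : Ell2 n →ₗᵢ[ℝ] Ell2 m),
    y ∈ K m → IsDilation α y x → IsTrivialDilation α y

end NCConvex

/-! ### Real operator systems and ucp maps -/

section Systems

variable {H₀ : Type*} [NormedAddCommGroup H₀] [InnerProductSpace ℝ H₀] [CompleteSpace H₀]

/-- A (concrete) real operator system: a unital selfadjoint subspace of `B(H₀)`. -/
structure IsOperatorSystem (V : Submodule ℝ (Op H₀)) : Prop where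
  one_mem : (1 : Op H₀) ∈ V
  star_mem : ∀ v ∈ V, star v ∈ V

/-- Unital completely positive maps on `V`, where
`M_k(V)⁺ = {a ∈ M_k(V) : a = a* ≥ 0 in B(H₀^(k))}`. -/
structure IsUCP {H : Type*} [NormedAddCommGroup H] [InnerProductSpace ℝ H]
    (V : Submodule ℝ (Op H₀)) (φ : V →ₗ[ℝ] Op H) : Prop where
  unital : ∀ v : V, (v : Op H₀) = 1 → φ v = 1
  completely_positive : ∀ (k : ℕ) (a : Fin k → Fin k → V),
    (blockOp fun i j => (a i j : Op H₀)).IsPositive → (blockOp fun i j => φ (a i j)).IsPositive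

/-- Unital complete order embeddings: injective ucp maps whose inverse on the range is ucp. -/
structure IsUCOE {H : Type*} [NormedAddCommGroup H] [InnerProductSpace ℝ H]
    (V : Submodule ℝ (Op H₀)) (j : V →ₗ[ℝ] Op H) : Prop where
  ucp : IsUCP V j
  injective : Function.Injective j
  reflects : ∀ (k : ℕ) (a : Fin k → Fin k → V),
    (blockOp fun i l => j (a i l)).IsPositive → (blockOp fun i l => (a i l : Op H₀)).IsPositive

/-- The real C*-algebra (norm closed unital `*`-subalgebra of `B(H)`) generated by `j(V)`,
as a subspace of `B(H)`. -/
def cstarGenerated {H : Type*} [NormedAddCommGroup H] [InnerProductSpace ℝ H] [CompleteSpace H]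
    {V : Submodule ℝ (Op H₀)} (j : V →ₗ[ℝ] Op H) : Submodule ℝ (Op H) :=
  (StarAlgebra.adjoin ℝ (Set.range j)).topologicalClosure.toSubalgebra.toSubmodule

/-- A ucp map `π : V → B(L)` is maximal if each of its ucp dilations is trivial. -/
def IsMaximalUCP {L : Type u} [NormedAddCommGroup L] [InnerProductSpace ℝ L] [CompleteSpace L]
    (V : Submodule ℝ (Op H₀)) (π : V →ₗ[ℝ] Op L) : Prop :=
  IsUCP V π ∧ ∀ (L' : Type u) [NormedAddCommGroup L'] [InnerProductSpace ℝ L'] [CompleteSpace L']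
    (ψ : V →ₗ[ℝ] Op L') (α : L →ₗᵢ[ℝ] L'),
    IsUCP V ψ → IsDilation α ψ π → IsTrivialDilation α ψ

/-- The unique extension property of a ucp map `π : V → B(L)`: for every real C*-algebra `B`
generated by a unital completely order isomorphic copy `j(V)` of `V` there is a unique ucp map
`ρ : B → B(L)` with `ρ ∘ j = π`, and `ρ` is a `*`-homomorphism. -/
def HasUEP {L : Type u} [NormedAddCommGroup L] [InnerProductSpace ℝ L] [CompleteSpace L]
    (V : Submodule ℝ (Op H₀)) (π : V →ₗ[ℝ] Op L) : Prop :=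
  ∀ (H : Type u) [NormedAddCommGroup H] [InnerProductSpace ℝ H] [CompleteSpace H]
    (j : V →ₗ[ℝ] Op H), IsUCOE V j →
    ∃ ρ : cstarGenerated j →ₗ[ℝ] Op L,
      IsUCP (cstarGenerated j) ρ ∧
      (∀ (v : V) (b : cstarGenerated j), (b : Op H) = j v → ρ b = π v) ∧
      (∀ a b c : cstarGenerated j, (c : Op H) = (a : Op H) * (b : Op H) → ρ c = ρ a * ρ b) ∧
      (∀ a b : cstarGenerated j, (b : Op H) = star (a : Op H) → ρ b = star (ρ a)) ∧
      ∀ ρ' : cstarGenerated j →ₗ[ℝ] Op L, IsUCP (cstarGenerated j) ρ' →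
        (∀ (v : V) (b : cstarGenerated j), (b : Op H) = j v → ρ' b = π v) → ρ' = ρ

end Systems

end RealNC

end

/-!
Both parts rest on one construction of maximal dilations, for any class of maps `P → B(E)` that is
closed under compressions and has limits of chains of successive dilations (`IsDilationClass`).

Fix a set `Λ` of more than `κ` coordinates and consider the maps of the class on the spaces `ℓ²(S)`
with `S ⊆ Λ` of cardinality at most `κ`, ordered by dilation along the inclusions of coordinate
spaces. For `f` in a dense set of at most `κ` elements and `s ∈ S`, the norms `‖y f e_s‖` and
`‖(y f)* e_s‖` only grow under dilation. By `exists_forall_ge_eq` they can all be frozen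
simultaneously; that lemma needs upper bounds only for chains of at most `κ` elements, for which the
union of the coordinate sets still has cardinality at most `κ`. Once these norms are
frozen, no further dilation can move the old basis vectors out of the space, because its compression
to one more dimension would increase one of the norms
(`Model.exists_le_forall_dilation_mem_range`). Repeating this countably often and passing to the
limit makes the space invariant under all further dilations and their adjoints, which is maximality
(`exists_maximal_dilation`).

The points of a compact nc convex set form such a class (`isDilationClass_pointOn`): the members of
a chain are padded by copies of a point of `K_1` to maps on the same space, and a limit exists by
compactness. The ucp maps on an operator system form such a class by taking weak limits along an
ultrafilter (`isDilationClass_ucp`).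

A maximal ucp map `π` has the unique extension property by Arveson's argument. M. Riesz' extension
theorem extends `π`, viewed as a functional on matrices, to a completely positive kernel on the
generated C*-algebra (`exists_cpKernel_extension`). The GNS representation of any such kernel
(`IsCPKernel.exists_gns`) restricts to a ucp dilation of `π`, which is trivial by maximality;
therefore its compression is a `*`-homomorphism (`IsMaximalUCP.exists_starHom`). Such a map is
determined by its values on the generators, which gives uniqueness as well.
-/

noncomputable section

namespace RealNC

/-! ### Positive matrices of operators and ucp maps -/

section PositiveMatrices

variable {H₀ H L : Type*}
  [NormedAddCommGroup H₀] [InnerProductSpace ℝ H₀]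
  [NormedAddCommGroup H] [InnerProductSpace ℝ H]
  [NormedAddCommGroup L] [InnerProductSpace ℝ L]

theorem inner_blockOp {k : ℕ} (a : Fin k → Fin k → Op H) (v w : PiLp 2 fun _ : Fin k => H) :
    ⟪blockOp a v, w⟫_ℝ = ∑ i, ∑ j, ⟪a i j (v j), w i⟫_ℝ := by
  simp [PiLp.inner_apply, blockOp_apply, sum_inner]

/-- Positivity of a matrix of operators indexed by an arbitrary finite type: the matrix is
self-adjoint and its quadratic form is nonnegative. -/
def PosMat {ι : Type*} [Fintype ι] (a : ι → ι → Op H) : Prop :=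
  (∀ i j u w, ⟪a i j u, w⟫_ℝ = ⟪u, a j i w⟫_ℝ) ∧ ∀ v : ι → H, 0 ≤ ∑ i, ∑ j, ⟪a i j (v j), v i⟫_ℝ

theorem isPositive_blockOp_iff {k : ℕ} (a : Fin k → Fin k → Op H) :
    (blockOp a).IsPositive ↔ PosMat a := by
  rw [ContinuousLinearMap.isPositive_iff]
  constructor
  · rintro ⟨h1, h2⟩
    refine ⟨fun i j u w => ?_, fun v => ?_⟩
    · have h := h1 (WithLp.toLp 2 (Pi.single j u)) (WithLp.toLp 2 (Pi.single i w))
      rw [ContinuousLinearMap.coe_coe, inner_blockOp, real_inner_comm, inner_blockOp] at h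
      rw [Finset.sum_eq_single i, Finset.sum_eq_single j, Finset.sum_eq_single j,
        Finset.sum_eq_single i] at h
      · simpa [real_inner_comm] using h
      all_goals simp +contextual [Pi.single_apply]
    · have := h2 (WithLp.toLp 2 v)
      rwa [inner_blockOp] at this
  · rintro ⟨h1, h2⟩
    refine ⟨fun v w => ?_, fun v => ?_⟩
    · rw [ContinuousLinearMap.coe_coe, inner_blockOp, real_inner_comm, inner_blockOp,
        Finset.sum_comm]
      refine Finset.sum_congr rfl fun i _ => Finset.sum_congr rfl fun j _ => ?_
      rw [h1, real_inner_comm]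
    · rw [inner_blockOp]
      exact h2 _

theorem PosMat.reindex {ι κ : Type*} [Fintype ι] [Fintype κ] (e : κ ≃ ι) {a : ι → ι → Op H}
    (h : PosMat a) : PosMat fun i j => a (e i) (e j) := by
  refine ⟨fun i j => h.1 _ _, fun v => ?_⟩
  have := h.2 (v ∘ e.symm)
  rw [← e.sum_comp] at this
  simp_rw [← e.sum_comp (fun j => ⟪a (e _) j _, _⟫_ℝ)] at this
  simpa using this

theorem IsUCP.posMat {V : Submodule ℝ (Op H₀)} {φ : V →ₗ[ℝ] Op H} (hφ : IsUCP V φ)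
    {ι : Type*} [Fintype ι] {a : ι → ι → V} (ha : PosMat fun i j => (a i j : Op H₀)) :
    PosMat fun i j => φ (a i j) := by
  have h1 := hφ.completely_positive _
    (fun i j => a ((Fintype.equivFin ι).symm i) ((Fintype.equivFin ι).symm j))
    ((isPositive_blockOp_iff _).2 (ha.reindex (Fintype.equivFin ι).symm))
  simpa using ((isPositive_blockOp_iff _).1 h1).reindex (Fintype.equivFin ι)

theorem opNorm_le_of_forall_form_nonneg {r : ℝ} (hr : 0 ≤ r) {T : Op H}
    (h : ∀ x y, 0 ≤ r * ‖x‖ ^ 2 + 2 * ⟪T x, y⟫_ℝ + r * ‖y‖ ^ 2) : ‖T‖ ≤ r := by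
  refine T.opNorm_le_bound hr fun x => ?_
  rcases hr.eq_or_lt with rfl | hr
  · have := h x (-(T x))
    simp only [inner_neg_right, real_inner_self_eq_norm_sq] at this
    nlinarith [norm_nonneg (T x)]
  · have := h (r • x) (-(T x))
    simp only [inner_neg_right, map_smul, real_inner_smul_left, real_inner_self_eq_norm_sq,
      norm_smul, norm_neg, Real.norm_eq_abs, abs_of_pos hr] at this
    have h2 : r * ‖T x‖ ^ 2 ≤ r * (r * ‖x‖) ^ 2 := by nlinarith
    exact le_of_sq_le_sq (le_of_mul_le_mul_left h2 hr) (by positivity)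
where
  le_of_sq_le_sq {a b : ℝ} (h : a ^ 2 ≤ b ^ 2) (hb : 0 ≤ b) : a ≤ b := by
    nlinarith [abs_le_of_sq_le_sq h hb, le_abs_self a]

variable [CompleteSpace H₀]

/-- The operator matrix `[[‖T‖, T], [T*, ‖T‖]]` is positive. -/
theorem posMat_norm_self_adjoint (T : Op H₀) :
    PosMat (![![‖T‖ • (1 : Op H₀), T], ![star T, ‖T‖ • (1 : Op H₀)]] : Fin 2 → Fin 2 → Op H₀) := by
  refine ⟨fun i j u w => ?_, fun v => ?_⟩
  · fin_cases i <;> fin_cases j <;>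
      simp [ContinuousLinearMap.star_eq_adjoint, ContinuousLinearMap.adjoint_inner_left,
        ContinuousLinearMap.adjoint_inner_right, real_inner_smul_left, real_inner_smul_right]
  · simp only [Fin.sum_univ_two, ContinuousLinearMap.star_eq_adjoint]
    simp only [Matrix.cons_val_zero, Matrix.cons_val_one, smul_apply,
      one_apply_eq_self, real_inner_smul_left, real_inner_self_eq_norm_sq,
      ContinuousLinearMap.adjoint_inner_left]
    rw [real_inner_comm (T (v 1)) (v 0)]
    have h1 := abs_real_inner_le_norm (T (v 1)) (v 0)
    have h2 := T.le_opNorm (v 1)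
    have h3 := neg_abs_le ⟪T (v 1), v 0⟫_ℝ
    have h4 : ‖T (v 1)‖ * ‖v 0‖ ≤ ‖T‖ * ‖v 1‖ * ‖v 0‖ := by gcongr
    nlinarith [mul_nonneg (norm_nonneg T) (sq_nonneg (‖v 0‖ - ‖v 1‖))]

theorem IsUCP.posMat_norm_self_adjoint {V : Submodule ℝ (Op H₀)} (hV : IsOperatorSystem V)
    {φ : V →ₗ[ℝ] Op H} (hφ : IsUCP V φ) (v : V) :
    PosMat (![![‖v‖ • (1 : Op H), φ v], ![φ ⟨star (v : Op H₀), hV.star_mem _ v.2⟩,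
      ‖v‖ • (1 : Op H)]] : Fin 2 → Fin 2 → Op H) := by
  let a : Fin 2 → Fin 2 → V := ![![‖v‖ • ⟨1, hV.one_mem⟩, v],
    ![⟨star (v : Op H₀), hV.star_mem _ v.2⟩, ‖v‖ • ⟨1, hV.one_mem⟩]]
  have h1 : (fun i j => (a i j : Op H₀)) =
      ![![‖v‖ • (1 : Op H₀), v], ![star (v : Op H₀), ‖v‖ • (1 : Op H₀)]] := by
    ext i j : 2
    fin_cases i <;> fin_cases j <;> rfl
  have h2 := hφ.posMat (a := a) (h1 ▸ RealNC.posMat_norm_self_adjoint (v : Op H₀))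
  convert h2 using 1
  ext i j : 2
  have h3 : φ (‖v‖ • ⟨1, hV.one_mem⟩) = ‖v‖ • (1 : Op H) := by
    rw [map_smul, hφ.unital ⟨1, hV.one_mem⟩ rfl]
  fin_cases i <;> fin_cases j
  exacts [h3.symm, rfl, rfl, h3.symm]

theorem IsUCP.norm_le {V : Submodule ℝ (Op H₀)} (hV : IsOperatorSystem V)
    {φ : V →ₗ[ℝ] Op H} (hφ : IsUCP V φ) (v : V) : ‖φ v‖ ≤ ‖v‖ := by
  have h := hφ.posMat_norm_self_adjoint hV v
  refine opNorm_le_of_forall_form_nonneg (norm_nonneg v) fun x y => ?_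
  have h1 := h.1 0 1 x y
  have h2 := h.2 ![y, x]
  simp [Fin.sum_univ_two, real_inner_smul_left] at h1 h2
  rw [real_inner_comm x, ← h1] at h2
  simp only [Submodule.coe_norm] at h2 ⊢
  linarith

theorem IsUCP.map_star {V : Submodule ℝ (Op H₀)} (hV : IsOperatorSystem V) [CompleteSpace H]
    {φ : V →ₗ[ℝ] Op H} (hφ : IsUCP V φ) {v w : V} (hw : (w : Op H₀) = star (v : Op H₀)) :
    φ w = star (φ v) := by
  have h := (hφ.posMat_norm_self_adjoint hV v).1 0 1
  have hw' : w = ⟨star (v : Op H₀), hV.star_mem _ v.2⟩ := Subtype.ext hw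
  refine hw' ▸ (ContinuousLinearMap.eq_adjoint_iff _ _).2 fun x y => ?_
  have := h y x
  simp at this
  rw [real_inner_comm, ← this, real_inner_comm]

end PositiveMatrices

/-! ### Preorders with upper bounds for small chains -/

/-- If every chain with at most `κ` elements has an upper bound, then at most `κ` monotone real
functions can be frozen simultaneously above some element. In the proof, Zorn's lemma is applied to
the relation "equal, or above with some `F t` strictly larger": a chain for it contains a cofinal
subset indexed by `T × ℚ`, unless it already has a largest element. -/
theorem exists_forall_ge_eq {α : Type u} [Preorder α] [Nonempty α] {T : Type u}
    {κ : Cardinal.{u}} (hκ : Cardinal.aleph0 ≤ κ) (hT : Cardinal.mk T ≤ κ) (F : T → α → ℝ)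
    (hF : ∀ t, Monotone (F t))
    (hchain : ∀ C : Set α, C.Nonempty → IsChain (· ≤ ·) C → Cardinal.mk C ≤ κ →
      ∃ u, ∀ c ∈ C, c ≤ u) :
    ∃ m, ∀ b, m ≤ b → ∀ t, F t b = F t m := by
  let r : α → α → Prop := fun a b => a = b ∨ (a ≤ b ∧ ∃ t, F t a < F t b)
  have hrle : ∀ {a b}, r a b → a ≤ b := by
    rintro a b (rfl | h)
    exacts [le_rfl, h.1]
  have htrans : ∀ {a b c}, r a b → r b c → r a c := by
    rintro a b c (rfl | ⟨h1, t, ht⟩) (rfl | ⟨h2, s, hs⟩)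
    · exact Or.inl rfl
    · exact Or.inr ⟨h2, s, hs⟩
    · exact Or.inr ⟨h1, t, ht⟩
    · exact Or.inr ⟨h1.trans h2, t, ht.trans_le (hF t h2)⟩
  obtain ⟨m, hm⟩ := exists_maximal_of_chains_bounded (r := r) (fun C hC => by
    by_cases htop : ∃ c ∈ C, ∀ d ∈ C, ∀ t, F t d ≤ F t c
    · obtain ⟨c, hc, hmax⟩ := htop
      refine ⟨c, fun d hd => ?_⟩
      by_cases hdc : d = c
      · exact Or.inl hdc
      rcases hC hd hc hdc with h | h | ⟨-, t, ht⟩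
      · exact h
      · exact Or.inl h.symm
      · exact absurd ht (not_lt.2 (hmax d hd t))
    push Not at htop
    rcases C.eq_empty_or_nonempty with rfl | ⟨c₀, hc₀⟩
    · exact ⟨Classical.arbitrary α, by simp⟩
    have hex : ∀ p : T × ℚ, ∃ c ∈ C, (∃ d ∈ C, (p.2 : ℝ) < F p.1 d) → (p.2 : ℝ) < F p.1 c := by
      intro p
      by_cases h : ∃ d ∈ C, (p.2 : ℝ) < F p.1 d
      · obtain ⟨d, hd, h⟩ := h
        exact ⟨d, hd, fun _ => h⟩
      · exact ⟨c₀, hc₀, fun h' => absurd h' h⟩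
    choose c hcC hc using hex
    have key : ∀ d ∈ C, ∃ p t, r d (c p) ∧ F t d < F t (c p) := by
      intro d hd
      obtain ⟨d', hd', t, ht⟩ := htop d hd
      obtain ⟨q, hq1, hq2⟩ := exists_rat_btwn ht
      have hlt : F t d < F t (c (t, q)) := hq1.trans (hc (t, q) ⟨d', hd', hq2⟩)
      refine ⟨(t, q), t, ?_, hlt⟩
      have hne : d ≠ c (t, q) := fun h => hlt.ne (congrArg (F t) h)
      rcases hC hd (hcC _) hne with h | h
      · exact h
      · exact absurd (hF t (hrle h)) (not_le.2 hlt)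
    obtain ⟨u, hu⟩ := hchain (Set.range c) (by
        obtain ⟨p, -⟩ := key c₀ hc₀
        exact ⟨_, p, rfl⟩) (by
        rintro _ ⟨p, rfl⟩ _ ⟨q, rfl⟩ hne
        exact (hC (hcC p) (hcC q) hne).imp hrle hrle)
      (Cardinal.mk_range_le.trans (by
        rw [Cardinal.mk_prod]
        simpa using Cardinal.mul_le_of_le hκ (by simpa using hT) hκ))
    refine ⟨u, fun d hd => ?_⟩
    obtain ⟨p, t, hr, hlt⟩ := key d hd
    have hcu := hu _ ⟨p, rfl⟩
    exact Or.inr ⟨(hrle hr).trans hcu, t, hlt.trans_le (hF t hcu)⟩) htrans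
  refine ⟨m, fun b hb t => ?_⟩
  refine le_antisymm (not_lt.1 fun hlt => ?_) (hF t hb)
  rcases hm b (Or.inr ⟨hb, t, hlt⟩) with h | h
  · exact hlt.ne (congrArg (F t) h.symm)
  · exact absurd (hF t h.1) (not_le.2 hlt)

/-! ### Compressions and the coordinate spaces `ℓ²(S)` -/

section Compression

variable {H₀ : Type*} [NormedAddCommGroup H₀] [InnerProductSpace ℝ H₀]
  {P : Submodule ℝ (Op H₀)}
  {E F G : Type*} [NormedAddCommGroup E] [InnerProductSpace ℝ E] [CompleteSpace E]
  [NormedAddCommGroup F] [InnerProductSpace ℝ F] [CompleteSpace F]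
  [NormedAddCommGroup G] [InnerProductSpace ℝ G] [CompleteSpace G]

/-- The compression `αᵀ y α` of a map `y : P → B(F)` along an isometry `α : E → F`. -/
def compress (α : E →ₗᵢ[ℝ] F) (y : P →ₗ[ℝ] Op F) : P →ₗ[ℝ] Op E where
  toFun f := ContinuousLinearMap.adjoint α.toContinuousLinearMap ∘L y f ∘L α.toContinuousLinearMap
  map_add' f g := by ext; simp
  map_smul' c f := by ext; simp

theorem isDilation_iff {α : E →ₗᵢ[ℝ] F} {y : P →ₗ[ℝ] Op F} {x : P →ₗ[ℝ] Op E} :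
    IsDilation α y x ↔ x = compress α y :=
  ⟨fun h => LinearMap.ext h, fun h _ => h ▸ rfl⟩

theorem compress_apply (α : E →ₗᵢ[ℝ] F) (y : P →ₗ[ℝ] Op F) (f : P) (u : E) :
    compress α y f u = ContinuousLinearMap.adjoint α.toContinuousLinearMap (y f (α u)) := rfl

theorem inner_compress (α : E →ₗᵢ[ℝ] F) (y : P →ₗ[ℝ] Op F) (f : P) (u v : E) :
    ⟪compress α y f u, v⟫_ℝ = ⟪y f (α u), α v⟫_ℝ := by
  simp [compress_apply, ContinuousLinearMap.adjoint_inner_left]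

theorem eq_compress_of_inner {α : E →ₗᵢ[ℝ] F} {y : P →ₗ[ℝ] Op F} {x : P →ₗ[ℝ] Op E}
    (h : ∀ f u v, ⟪x f u, v⟫_ℝ = ⟪y f (α u), α v⟫_ℝ) : x = compress α y := by
  ext f u
  exact ext_inner_right ℝ fun v => by rw [h, inner_compress]

theorem adjoint_compress_apply (α : E →ₗᵢ[ℝ] F) (y : P →ₗ[ℝ] Op F) (f : P) (u : E) :
    ContinuousLinearMap.adjoint (compress α y f) u =
      ContinuousLinearMap.adjoint α.toContinuousLinearMap
        (ContinuousLinearMap.adjoint (y f) (α u)) := by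
  refine ext_inner_right ℝ fun v => ?_
  rw [ContinuousLinearMap.adjoint_inner_left, real_inner_comm, inner_compress,
    ContinuousLinearMap.adjoint_inner_left, ContinuousLinearMap.adjoint_inner_left,
    real_inner_comm]
  rfl

theorem compress_compress (α : E →ₗᵢ[ℝ] F) (β : F →ₗᵢ[ℝ] G) (y : P →ₗ[ℝ] Op G) :
    compress α (compress β y) = compress (β.comp α) y :=
  eq_compress_of_inner fun f u v => by simp [inner_compress]

theorem compress_id (y : P →ₗ[ℝ] Op E) : compress LinearIsometry.id y = y :=
  (eq_compress_of_inner fun _ _ _ => rfl).symm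

theorem adjoint_isometry_apply (α : E →ₗᵢ[ℝ] F) (u : E) :
    ContinuousLinearMap.adjoint α.toContinuousLinearMap (α u) = u :=
  ext_inner_right ℝ fun v => by simp [ContinuousLinearMap.adjoint_inner_left]

theorem norm_adjoint_isometry_le (α : E →ₗᵢ[ℝ] F) (w : F) :
    ‖ContinuousLinearMap.adjoint α.toContinuousLinearMap w‖ ≤ ‖w‖ := by
  refine (ContinuousLinearMap.le_opNorm _ _).trans ?_
  rw [LinearIsometryEquiv.norm_map]
  exact mul_le_of_le_one_left (norm_nonneg _) α.norm_toContinuousLinearMap_le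

theorem norm_sq_sub_adjoint_isometry (α : E →ₗᵢ[ℝ] F) (w : F) :
    ‖w - α (ContinuousLinearMap.adjoint α.toContinuousLinearMap w)‖ ^ 2 =
      ‖w‖ ^ 2 - ‖ContinuousLinearMap.adjoint α.toContinuousLinearMap w‖ ^ 2 := by
  have h : ⟪w, α (ContinuousLinearMap.adjoint α.toContinuousLinearMap w)⟫_ℝ =
      ‖ContinuousLinearMap.adjoint α.toContinuousLinearMap w‖ ^ 2 := by
    rw [← real_inner_self_eq_norm_sq, ContinuousLinearMap.adjoint_inner_left]
    rfl
  rw [norm_sub_sq_real, h, α.norm_map]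
  ring

/-- A dilation is trivial once the range of the isometry is invariant for the dilation and for its
adjoint. -/
theorem isTrivialDilation_of_range {α : E →ₗᵢ[ℝ] F} {y : P →ₗ[ℝ] Op F}
    (h : ∀ f u, y f (α u) ∈ Set.range α ∧
      ContinuousLinearMap.adjoint (y f) (α u) ∈ Set.range α) : IsTrivialDilation α y := by
  intro f
  ext w
  refine ext_inner_right ℝ fun v => ?_
  obtain ⟨a, ha⟩ := (h f (ContinuousLinearMap.adjoint α.toContinuousLinearMap w)).1
  obtain ⟨b, hb⟩ := (h f (ContinuousLinearMap.adjoint α.toContinuousLinearMap v)).2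
  have key : ∀ w : F, α.toContinuousLinearMap
      (ContinuousLinearMap.adjoint α.toContinuousLinearMap w) =
      α (ContinuousLinearMap.adjoint α.toContinuousLinearMap w) := fun _ => rfl
  have hself : ∀ w v : F, ⟪α (ContinuousLinearMap.adjoint α.toContinuousLinearMap w), v⟫_ℝ =
      ⟪w, α (ContinuousLinearMap.adjoint α.toContinuousLinearMap v)⟫_ℝ := fun w v => by
    rw [← key, ← key, ← ContinuousLinearMap.adjoint_inner_right,
      ContinuousLinearMap.adjoint_inner_left]
  have ha' : ⟪α a, v⟫_ℝ =
      ⟪α a, α (ContinuousLinearMap.adjoint α.toContinuousLinearMap v)⟫_ℝ := by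
    rw [← hself, adjoint_isometry_apply]
  have hb' : ⟪α (ContinuousLinearMap.adjoint α.toContinuousLinearMap w), α b⟫_ℝ = ⟪w, α b⟫_ℝ := by
    rw [hself, adjoint_isometry_apply]
  simp only [mul_apply_eq_comp, ContinuousLinearMap.comp_apply, key]
  rw [← ha, ha', ha, ← ContinuousLinearMap.adjoint_inner_right, ← hb, hb', hb,
    ContinuousLinearMap.adjoint_inner_right, hself]

end Compression

section Coordinates

variable {ι : Type*} {E : Type*} [NormedAddCommGroup E] [InnerProductSpace ℝ E]

open Classical in
/-- The standard basis vector of `ℓ²(ι)`. -/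
def stdVec (i : ι) : lp (fun _ : ι => ℝ) 2 := lp.single 2 i 1

theorem orthonormal_stdVec : Orthonormal ℝ (stdVec : ι → lp (fun _ : ι => ℝ) 2) := by
  classical
  rw [orthonormal_iff_ite]
  intro i j
  simp only [stdVec, lp.inner_single_left, lp.single_apply]
  by_cases h : i = j
  · subst h; simp
  · simp [h]

theorem inner_stdVec (w : lp (fun _ : ι => ℝ) 2) (i : ι) : ⟪w, stdVec i⟫_ℝ = w i := by
  classical
  rw [stdVec, lp.inner_single_right]
  simp

theorem hasSum_stdVec (w : lp (fun _ : ι => ℝ) 2) : HasSum (fun i => w i • stdVec i) w := by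
  classical
  have e : (fun i => w i • (stdVec i : lp (fun _ : ι => ℝ) 2)) = fun i => lp.single 2 i (w i) := by
    funext i
    rw [stdVec, ← lp.single_smul]
    simp
  rw [e]
  exact lp.hasSum_single (by norm_num) w

theorem clm_ext_stdVec {F : Type*} [NormedAddCommGroup F] [NormedSpace ℝ F]
    {A B : lp (fun _ : ι => ℝ) 2 →L[ℝ] F} (h : ∀ i, A (stdVec i) = B (stdVec i)) : A = B := by
  classical
  refine lp.ext_continuousLinearMap (by norm_num) fun i => ?_
  ext
  simpa [stdVec] using h i

theorem mem_of_forall_stdVec {N : Submodule ℝ (lp (fun _ : ι => ℝ) 2)}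
    (hN : IsClosed (N : Set (lp (fun _ : ι => ℝ) 2))) (h : ∀ i, stdVec i ∈ N)
    (v : lp (fun _ : ι => ℝ) 2) : v ∈ N := by
  exact hN.mem_of_tendsto (hasSum_stdVec v) (Filter.Eventually.of_forall fun s =>
    N.sum_mem fun i _ => N.smul_mem _ (h i))

/-- The isometry `ℓ²(ι) → E` that maps the standard basis to a given orthonormal family. -/
def ofOrthonormal [CompleteSpace E] {v : ι → E} (hv : Orthonormal ℝ v) :
    lp (fun _ : ι => ℝ) 2 →ₗᵢ[ℝ] E :=
  hv.orthogonalFamily.linearIsometry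

theorem ofOrthonormal_stdVec [CompleteSpace E] {v : ι → E} (hv : Orthonormal ℝ v) (i : ι) :
    ofOrthonormal hv (stdVec i) = v i := by
  classical
  simp [ofOrthonormal, stdVec, OrthogonalFamily.linearIsometry_apply_single]

/-- A Hilbert basis, reindexed along a bijection of the index types. -/
def reindexBasis [CompleteSpace E] {κ : Type*} (b : HilbertBasis ι ℝ E) (e : κ ≃ ι) :
    HilbertBasis κ ℝ E :=
  HilbertBasis.mk (v := b ∘ e) (b.orthonormal.comp _ e.injective) (by
    rw [e.surjective.range_comp, b.dense_span])

/-- The Hilbert space `ℓ²(S)` on a set `S` of coordinates. -/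
abbrev L2 {Λ : Type*} (S : Set Λ) := lp (fun _ : S => ℝ) 2

variable {Λ : Type*}

/-- The inclusion `ℓ²(S) → ℓ²(S')` for `S ⊆ S'`. -/
def incl {S S' : Set Λ} (h : S ⊆ S') : L2 S →ₗᵢ[ℝ] L2 S' :=
  ofOrthonormal (v := fun s : S => stdVec (⟨s, h s.2⟩ : S'))
    (orthonormal_stdVec.comp (fun s : S => (⟨s, h s.2⟩ : S')) (Set.inclusion_injective h))

theorem incl_stdVec {S S' : Set Λ} (h : S ⊆ S') (s : S) :
    incl h (stdVec s) = stdVec ⟨s, h s.2⟩ := ofOrthonormal_stdVec _ _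

theorem isometry_ext_stdVec {α β : lp (fun _ : ι => ℝ) 2 →ₗᵢ[ℝ] E}
    (h : ∀ i, α (stdVec i) = β (stdVec i)) : α = β := by
  have := clm_ext_stdVec (A := α.toContinuousLinearMap) (B := β.toContinuousLinearMap) h
  ext v
  exact DFunLike.congr_fun this v

theorem incl_comp_incl {S S' S'' : Set Λ} (h : S ⊆ S') (h' : S' ⊆ S'') :
    (incl h').comp (incl h) = incl (h.trans h') :=
  isometry_ext_stdVec fun s => by simp [incl_stdVec]

theorem incl_refl (S : Set Λ) : incl (subset_refl S) = LinearIsometry.id :=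
  isometry_ext_stdVec fun s => by simp [incl_stdVec]

end Coordinates

/-! ### Maximal dilations in a class closed under compressions and limits of chains -/

section Framework

variable {H₀ : Type u} [NormedAddCommGroup H₀] [InnerProductSpace ℝ H₀]

/-- A class `Q` of linear maps from `P` into the algebras `B(E)`, stable under the operations from
which maximal dilations are built. Both the points of a compact nc convex set and the ucp maps on an
operator system form such a class. -/
structure IsDilationClass (P : Submodule ℝ (Op H₀)) (κ : Cardinal.{u})
    (Q : ∀ (E : Type u) [NormedAddCommGroup E] [InnerProductSpace ℝ E] [CompleteSpace E],
      (P →ₗ[ℝ] Op E) → Prop) : Prop where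
  /-- `Q` is closed under compressions; a compression to the zero space is only allowed if the map
  already acts on the zero space. -/
  compress : ∀ (E F : Type u) [NormedAddCommGroup E] [InnerProductSpace ℝ E] [CompleteSpace E]
    [NormedAddCommGroup F] [InnerProductSpace ℝ F] [CompleteSpace F]
    (α : E →ₗᵢ[ℝ] F) (y : P →ₗ[ℝ] Op F), Q F y → (Nontrivial F → Nontrivial E) →
    Q E (compress α y)
  /-- the maps in `Q` are bounded -/
  bounded : ∀ (E : Type u) [NormedAddCommGroup E] [InnerProductSpace ℝ E] [CompleteSpace E]
    (y : P →ₗ[ℝ] Op E), Q E y → ∃ C : ℝ, ∀ f, ‖y f‖ ≤ C * ‖f‖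
  /-- a directed family of successive dilations on spaces `ℓ²(S i)` has a common dilation on
  `ℓ²(⋃ i, S i)` -/
  limit : ∀ (Λ I : Type u) [Preorder I] [IsDirectedOrder I] [Nonempty I]
    (S : I → Set Λ) (hS : Monotone S) (y : ∀ i, P →ₗ[ℝ] Op (L2 (S i))),
    (∀ i j (h : i ≤ j), y i = RealNC.compress (incl (hS h)) (y j)) →
    Cardinal.mk (⋃ i, S i) ≤ κ → (∀ i, Q (L2 (S i)) (y i)) →
    ∃ z : P →ₗ[ℝ] Op (L2 (⋃ i, S i)), Q _ z ∧
      ∀ i, y i = RealNC.compress (incl (Set.subset_iUnion S i)) z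

variable {P : Submodule ℝ (Op H₀)} {κ : Cardinal.{u}}
  {Q : ∀ (E : Type u) [NormedAddCommGroup E] [InnerProductSpace ℝ E] [CompleteSpace E],
      (P →ₗ[ℝ] Op E) → Prop}

/-- A map of the class `Q` on a coordinate space `ℓ²(S)` with `S ⊆ Λ` of cardinality at most `κ`. -/
structure Model (Q : ∀ (E : Type u) [NormedAddCommGroup E] [InnerProductSpace ℝ E]
    [CompleteSpace E], (P →ₗ[ℝ] Op E) → Prop) (κ : Cardinal.{u}) (Λ : Type u) where
  /-- the set of coordinates -/
  S : Set Λ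
  /-- the map -/
  map : P →ₗ[ℝ] Op (L2 S)
  card_le : Cardinal.mk S ≤ κ
  mem : Q (L2 S) map

/-- `a ≤ b` means that `b` is a dilation of `a` along the inclusion of coordinate spaces. -/
instance (Λ : Type u) : Preorder (Model Q κ Λ) where
  le a b := ∃ h : a.S ⊆ b.S, a.map = compress (incl h) b.map
  le_refl a := ⟨subset_rfl, by rw [incl_refl, compress_id]⟩
  le_trans a b c := by
    rintro ⟨h1, e1⟩ ⟨h2, e2⟩
    exact ⟨h1.trans h2, by rw [e1, e2, compress_compress, incl_comp_incl]⟩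

namespace Model

variable {Λ : Type u}

theorem subset_of_le {a b : Model Q κ Λ} (h : a ≤ b) : a.S ⊆ b.S := h.1

theorem map_eq_of_le {a b : Model Q κ Λ} (h : a ≤ b) :
    a.map = compress (incl (subset_of_le h)) b.map := h.2

/-- The upper bound lives on the union of the coordinate sets. -/
theorem exists_upperBound (hQ : IsDilationClass P κ Q) (hκ : Cardinal.aleph0 ≤ κ)
    (C : Set (Model Q κ Λ)) (hne : C.Nonempty) (hC : IsChain (· ≤ ·) C)
    (hcard : Cardinal.mk C ≤ κ) :
    ∃ u : Model Q κ Λ, (∀ c ∈ C, c ≤ u) ∧ ∀ s ∈ u.S, ∃ c ∈ C, s ∈ c.S := by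
  have : Nonempty C := hne.to_subtype
  have : IsDirectedOrder C := ⟨fun a b => by
    by_cases hab : a.1 = b.1
    · exact ⟨b, by rw [← Subtype.coe_le_coe, hab], le_rfl⟩
    rcases hC a.2 b.2 hab with h | h
    · exact ⟨b, h, le_rfl⟩
    · exact ⟨a, le_rfl, h⟩⟩
  have hle : Cardinal.mk (⋃ i : C, i.1.S) ≤ κ := by
    refine (Cardinal.mk_iUnion_le_sum_mk).trans ((Cardinal.sum_le_sum _ (fun _ => κ)
      fun i => i.1.card_le).trans ?_)
    simpa using Cardinal.mul_le_of_le hκ hcard le_rfl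
  obtain ⟨z, hz, hyz⟩ := hQ.limit Λ C (fun i => i.1.S) (fun a b h => subset_of_le h)
    (fun i => i.1.map) (fun i j h => map_eq_of_le h) hle (fun i => i.1.mem)
  refine ⟨⟨_, z, hle, hz⟩, fun c hc => ⟨_, hyz ⟨c, hc⟩⟩, fun s hs => ?_⟩
  obtain ⟨c, hc⟩ := Set.mem_iUnion.1 hs
  exact ⟨c.1, c.2, hc⟩

/-- The operator `T` or its adjoint, according to the value of `b`. -/
def opOrAdjoint {E : Type*} [NormedAddCommGroup E] [InnerProductSpace ℝ E] [CompleteSpace E]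
    (b : Bool) (T : Op E) : Op E := bif b then T else ContinuousLinearMap.adjoint T

theorem opOrAdjoint_compress {E F : Type*} [NormedAddCommGroup E] [InnerProductSpace ℝ E]
    [CompleteSpace E] [NormedAddCommGroup F] [InnerProductSpace ℝ F] [CompleteSpace F]
    (b : Bool) (α : E →ₗᵢ[ℝ] F) (y : P →ₗ[ℝ] Op F) (f : P) (u : E) :
    opOrAdjoint b (RealNC.compress α y f) u =
      ContinuousLinearMap.adjoint α.toContinuousLinearMap (opOrAdjoint b (y f) (α u)) := by
  cases b
  · exact adjoint_compress_apply α y f u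
  · exact compress_apply α y f u

/-- The key step: some dilation `b` of `a` is so large that every further dilation maps the basis
vectors of `ℓ²(a.S)` into `ℓ²(b.S)`. Here `b` maximizes all `‖b.map f e_s‖` and `‖(b.map f)* e_s‖`;
a dilation violating the claim could be compressed to `ℓ²(b.S)` plus one further dimension and would
increase one of these norms. -/
theorem exists_le_forall_dilation_mem_range (hQ : IsDilationClass P κ Q) (hκ : Cardinal.aleph0 ≤ κ)
    (hΛ : κ < Cardinal.mk Λ) {D : Set P} (hD : Cardinal.mk D ≤ κ) (a : Model Q κ Λ) :
    ∃ b : Model Q κ Λ, ∃ hab : a ≤ b, ∀ (E : Type u) [NormedAddCommGroup E]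
      [InnerProductSpace ℝ E] [CompleteSpace E] (z : P →ₗ[ℝ] Op E) (β : L2 b.S →ₗᵢ[ℝ] E),
      Q E z → b.map = compress β z → ∀ f ∈ D, ∀ s : a.S, ∀ i : Bool,
        opOrAdjoint i (z f) (β (stdVec ⟨s, subset_of_le hab s.2⟩)) ∈ Set.range β := by
  let F : (Bool × D × a.S) → {b : Model Q κ Λ // a ≤ b} → ℝ := fun t b =>
    ‖opOrAdjoint t.1 (b.1.map t.2.1) (stdVec ⟨t.2.2, subset_of_le b.2 t.2.2.2⟩)‖
  have : Nonempty {b : Model Q κ Λ // a ≤ b} := ⟨⟨a, le_rfl⟩⟩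
  have hT : Cardinal.mk (Bool × D × a.S) ≤ κ := by
    rw [Cardinal.mk_prod, Cardinal.mk_prod]
    simp only [Cardinal.lift_uzero, Cardinal.mk_bool, Cardinal.lift_ofNat, Cardinal.lift_id]
    exact Cardinal.mul_le_of_le hκ ((Cardinal.ofNat_lt_aleph0).le.trans hκ)
      (Cardinal.mul_le_of_le hκ hD a.card_le)
  obtain ⟨⟨b, hab⟩, hb⟩ := exists_forall_ge_eq hκ hT F (fun t b c hbc => by
      simp only [F]
      have hbc' : b.1 ≤ c.1 := hbc
      rw [map_eq_of_le hbc', opOrAdjoint_compress, incl_stdVec]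
      exact norm_adjoint_isometry_le _ _) (fun C hne hC hcard => by
      obtain ⟨u, hu, -⟩ := exists_upperBound hQ hκ (Subtype.val '' C) (hne.image _)
        (by
          rintro _ ⟨x, hx, rfl⟩ _ ⟨y, hy, rfl⟩ hne
          exact hC hx hy fun h => hne (congrArg _ h)) (Cardinal.mk_image_le.trans hcard)
      obtain ⟨c, hc⟩ := hne
      exact ⟨⟨u, c.2.trans (hu _ ⟨c, hc, rfl⟩)⟩, fun d hd => hu _ ⟨d, hd, rfl⟩⟩)
  refine ⟨b, hab, fun E _ _ _ z β hz hbz f hf s i => ?_⟩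
  by_contra hmem
  set w := opOrAdjoint i (z f) (β (stdVec ⟨s, subset_of_le hab s.2⟩)) with hw
  set p := ContinuousLinearMap.adjoint β.toContinuousLinearMap w with hp
  set r := w - β p with hr
  have hr0 : r ≠ 0 := fun h => hmem ⟨p, (sub_eq_zero.1 h).symm⟩
  have hrβ : ∀ u, ⟪β u, r⟫_ℝ = 0 := fun u => by
    rw [hr, inner_sub_right, β.inner_map_map, hp, ContinuousLinearMap.adjoint_inner_right]
    exact sub_self _
  obtain ⟨l, hl⟩ : ∃ l, l ∉ b.S := by
    by_contra! h
    have : b.S = Set.univ := Set.eq_univ_of_forall h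
    have := b.card_le
    rw [‹b.S = Set.univ›, Cardinal.mk_univ] at this
    exact absurd this (not_le.2 hΛ)
  classical
  -- The new coordinate `l` carries the component `r` of `w` orthogonal to the range of `β`.
  let S' : Set Λ := insert l b.S
  have hbS' : b.S ⊆ S' := Set.subset_insert _ _
  let v : S' → E := fun t => if h : t.1 ∈ b.S then β (stdVec ⟨t.1, h⟩) else ‖r‖⁻¹ • r
  have hv : Orthonormal ℝ v := by
    constructor
    · intro t
      by_cases h : t.1 ∈ b.S
      · simp only [v, dif_pos h, β.norm_map]
        exact orthonormal_stdVec.1 _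
      · simp only [v, dif_neg h, norm_smul, norm_inv, norm_norm]
        exact inv_mul_cancel₀ (norm_ne_zero_iff.2 hr0)
    · intro t t' htt
      by_cases h : t.1 ∈ b.S <;> by_cases h' : t'.1 ∈ b.S
      · simp only [v, dif_pos h, dif_pos h', β.inner_map_map]
        exact orthonormal_stdVec.2 fun e => htt (Subtype.ext (Subtype.mk.inj e))
      · simp [v, dif_pos h, dif_neg h', real_inner_smul_right, hrβ]
      · simp only [v, dif_neg h, dif_pos h', real_inner_smul_left]
        rw [real_inner_comm, hrβ, mul_zero]
      · exact absurd (Subtype.ext ((t.2.resolve_right h).trans (t'.2.resolve_right h').symm)) htt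
  let γ : L2 S' →ₗᵢ[ℝ] E := ofOrthonormal hv
  have hγ : γ.comp (incl hbS') = β := isometry_ext_stdVec fun t => by
    simp [γ, incl_stdVec, ofOrthonormal_stdVec, v]
  have hnontriv : Nontrivial (L2 S') :=
    ⟨⟨stdVec ⟨l, Set.mem_insert _ _⟩, 0, orthonormal_stdVec.ne_zero _⟩⟩
  let c : Model Q κ Λ := ⟨S', compress γ z,
    (Cardinal.mk_insert_le).trans (Cardinal.add_le_of_le hκ b.card_le
      (Cardinal.one_le_aleph0.trans hκ)), hQ.compress _ _ γ z hz fun _ => hnontriv⟩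
  have hbc : b ≤ c := ⟨hbS', by rw [compress_compress, hγ, hbz]⟩
  have hF := hb ⟨c, hab.trans hbc⟩ hbc (i, ⟨f, hf⟩, s)
  have hγs : γ (stdVec ⟨s, hbS' (subset_of_le hab s.2)⟩) =
      β (stdVec ⟨s, subset_of_le hab s.2⟩) := by
    exact (congrArg γ (incl_stdVec hbS' ⟨s.1, subset_of_le hab s.2⟩)).symm.trans
      (DFunLike.congr_fun hγ _)
  have hwγ : w = γ (incl hbS' p + ‖r‖ • stdVec ⟨l, Set.mem_insert _ _⟩) := by
    have h1 : γ (stdVec ⟨l, Set.mem_insert _ _⟩) = ‖r‖⁻¹ • r := by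
      simp [γ, ofOrthonormal_stdVec, v, hl]
    have h2 : γ (incl hbS' p) = β p := by rw [← hγ]; rfl
    rw [map_add, map_smul, h1, h2, smul_inv_smul₀ (norm_ne_zero_iff.2 hr0), hr]
    abel
  have h1 : F (i, ⟨f, hf⟩, s) ⟨c, hab.trans hbc⟩ = ‖w‖ := by
    change ‖opOrAdjoint i (compress γ z f) _‖ = _
    rw [opOrAdjoint_compress]
    change ‖ContinuousLinearMap.adjoint γ.toContinuousLinearMap (opOrAdjoint i (z f)
      (γ (stdVec ⟨s, hbS' (subset_of_le hab s.2)⟩)))‖ = _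
    rw [hγs, ← hw, hwγ, adjoint_isometry_apply, γ.norm_map]
  have h2 : F (i, ⟨f, hf⟩, s) ⟨b, hab⟩ = ‖p‖ := by
    change ‖opOrAdjoint i (b.map f) _‖ = _
    rw [hbz, opOrAdjoint_compress]
  -- Maximality of `b` forces `‖w‖ = ‖p‖`, hence `r = 0`.
  rw [h1, h2] at hF
  have h3 := norm_sq_sub_adjoint_isometry β w
  rw [← hp, ← hr, hF, sub_self] at h3
  exact hr0 (norm_eq_zero.1 (pow_eq_zero_iff two_ne_zero |>.1 h3))

/-- Iterating the key step countably often and passing to the limit gives a maximal dilation. -/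
theorem exists_le_maximal (hQ : IsDilationClass P κ Q) (hκ : Cardinal.aleph0 ≤ κ)
    (hΛ : κ < Cardinal.mk Λ) {D : Set P} (hDd : Dense D) (hD : Cardinal.mk D ≤ κ)
    (a : Model Q κ Λ) :
    ∃ b : Model Q κ Λ, a ≤ b ∧ ∀ (E : Type u) [NormedAddCommGroup E]
      [InnerProductSpace ℝ E] [CompleteSpace E] (z : P →ₗ[ℝ] Op E) (β : L2 b.S →ₗᵢ[ℝ] E),
      Q E z → b.map = compress β z → IsTrivialDilation β z := by
  choose g hag hg using
    fun a : Model Q κ Λ => exists_le_forall_dilation_mem_range hQ hκ hΛ hD a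
  let b : ℕ → Model Q κ Λ := fun n => g^[n] a
  have hb : ∀ n, b (n + 1) = g (b n) := fun n => Function.iterate_succ_apply' g n a
  have hmono : Monotone b := monotone_nat_of_le_succ fun n => by rw [hb]; exact hag _
  obtain ⟨u, hu, huS⟩ := exists_upperBound hQ hκ (Set.range b) ⟨_, 0, rfl⟩
    hmono.isChain_range
    ((Cardinal.mk_le_aleph0_iff.2 (Set.countable_range b).to_subtype).trans hκ)
  refine ⟨u, hu _ ⟨0, rfl⟩, fun E _ _ _ z β hz huz => ?_⟩
  obtain ⟨C, hC⟩ := hQ.bounded E z hz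
  have hcont : ∀ (i : Bool) (h : E), Continuous fun f : P => opOrAdjoint i (z f) h := by
    intro i h
    have hz' : Continuous z := AddMonoidHomClass.continuous_of_bound z C hC
    cases i
    · exact ((ContinuousLinearMap.adjoint (𝕜 := ℝ)).continuous.comp hz').clm_apply
        continuous_const
    · exact hz'.clm_apply continuous_const
  have hclosed : IsClosed (Set.range β) := β.isometry.isClosedEmbedding.isClosed_range
  have h1 : ∀ (i : Bool), ∀ f ∈ D, ∀ s : u.S,
      opOrAdjoint i (z f) (β (stdVec s)) ∈ Set.range β := by
    intro i f hf s
    obtain ⟨_, ⟨n, rfl⟩, hs⟩ := huS s s.2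
    have hnu : g (b n) ≤ u := hb n ▸ hu _ ⟨n + 1, rfl⟩
    have := hg (b n) E z (β.comp (incl (subset_of_le hnu))) hz
      (by rw [map_eq_of_le hnu, huz, compress_compress]) f hf ⟨s, hs⟩ i
    rw [LinearIsometry.coe_comp, Function.comp_apply, incl_stdVec] at this
    obtain ⟨t, ht⟩ := this
    exact ⟨_, ht⟩
  have h2 : ∀ (i : Bool) (f : P) (s : u.S),
      opOrAdjoint i (z f) (β (stdVec s)) ∈ Set.range β := fun i f s =>
    hDd.induction (P := fun f => opOrAdjoint i (z f) (β (stdVec s)) ∈ Set.range β)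
      (fun f hf => h1 i f hf s) (hclosed.preimage (hcont i _)) f
  have h3 : ∀ (i : Bool) (f : P) (h : L2 u.S),
      opOrAdjoint i (z f) (β h) ∈ Set.range β := by
    intro i f h
    let N : Submodule ℝ (L2 u.S) :=
      (LinearMap.range β.toLinearMap).comap
        ((opOrAdjoint i (z f)).comp β.toContinuousLinearMap).toLinearMap
    exact mem_of_forall_stdVec (N := N)
      (hclosed.preimage ((opOrAdjoint i (z f)).comp β.toContinuousLinearMap).continuous)
      (h2 i f) h
  exact isTrivialDilation_of_range fun f h => ⟨h3 true f h, h3 false f h⟩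

end Model

theorem exists_maximal_dilation (hQ : IsDilationClass P κ Q) (hκ : Cardinal.aleph0 ≤ κ)
    {D : Set P} (hDd : Dense D) (hD : Cardinal.mk D ≤ κ)
    {E : Type u} [NormedAddCommGroup E] [InnerProductSpace ℝ E] [CompleteSpace E]
    {ι : Type u} (b : HilbertBasis ι ℝ E) (hι : Cardinal.mk ι ≤ κ) {x : P →ₗ[ℝ] Op E}
    (hx : Q E x) :
    ∃ (F : Type u) (_ : NormedAddCommGroup F) (_ : InnerProductSpace ℝ F) (_ : CompleteSpace F)
      (y : P →ₗ[ℝ] Op F) (α : E →ₗᵢ[ℝ] F), Q F y ∧ x = compress α y ∧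
      ∀ (G : Type u) [NormedAddCommGroup G] [InnerProductSpace ℝ G] [CompleteSpace G]
        (z : P →ₗ[ℝ] Op G) (β : F →ₗᵢ[ℝ] G), Q G z → y = compress β z →
        IsTrivialDilation β z := by
  -- More than `κ` coordinates are needed, so that every model leaves room for one more dimension.
  let Λ : Type u := (Order.succ κ).out
  have hΛ : κ < Cardinal.mk Λ := by
    rw [Cardinal.mk_out]; exact Order.lt_succ κ
  obtain ⟨g⟩ : Nonempty (ι ↪ Λ) := (Cardinal.le_def _ _).1 (hι.trans hΛ.le)
  let e : ι ≃ Set.range g := Equiv.ofInjective g g.injective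
  let b' : HilbertBasis (Set.range g) ℝ E := reindexBasis b e.symm
  let a : Model Q κ Λ := ⟨Set.range g, compress b'.repr.symm.toLinearIsometry x,
    Cardinal.mk_range_le.trans hι, hQ.compress _ _ _ _ hx fun _ => b'.repr.symm.toEquiv.nontrivial⟩
  obtain ⟨c, hac, hc⟩ := a.exists_le_maximal hQ hκ hΛ hDd hD
  refine ⟨L2 c.S, inferInstance, inferInstance, inferInstance, c.map,
    (incl (Model.subset_of_le hac)).comp b'.repr.toLinearIsometry, c.mem, ?_, hc⟩
  have h := Model.map_eq_of_le hac
  rw [← compress_compress, ← h, compress_compress]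
  refine eq_compress_of_inner fun f u v => ?_
  simp

end Framework

/-! ### Complete boundedness -/

section CB

variable {H₀ H E F : Type*}
  [NormedAddCommGroup H₀] [InnerProductSpace ℝ H₀]
  [NormedAddCommGroup H] [InnerProductSpace ℝ H]
  [NormedAddCommGroup E] [InnerProductSpace ℝ E] [CompleteSpace E]
  [NormedAddCommGroup F] [InnerProductSpace ℝ F] [CompleteSpace F]

theorem norm_sq_blockOp_apply {k : ℕ} (a : Fin k → Fin k → Op H) (v : PiLp 2 fun _ : Fin k => H) :
    ‖blockOp a v‖ ^ 2 = ∑ i, ‖∑ j, a i j (v j)‖ ^ 2 := by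
  simp [PiLp.norm_sq_eq_of_L2, blockOp_apply]

theorem sum_norm_sq_le {k : ℕ} (a : Fin k → Fin k → Op H) (v : Fin k → H) :
    ∑ i, ‖∑ j, a i j (v j)‖ ^ 2 ≤ ‖blockOp a‖ ^ 2 * ∑ j, ‖v j‖ ^ 2 := by
  have h := (blockOp a).le_opNorm (WithLp.toLp 2 v)
  have h2 := pow_le_pow_left₀ (norm_nonneg _) h 2
  rw [norm_sq_blockOp_apply, mul_pow, PiLp.norm_sq_eq_of_L2] at h2
  exact h2

theorem norm_blockOp_le {k : ℕ} {a : Fin k → Fin k → Op H} {M : ℝ} (hM : 0 ≤ M)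
    (h : ∀ v : Fin k → H, ∑ i, ‖∑ j, a i j (v j)‖ ^ 2 ≤ M ^ 2 * ∑ j, ‖v j‖ ^ 2) :
    ‖blockOp a‖ ≤ M := by
  refine ContinuousLinearMap.opNorm_le_bound _ hM fun v => ?_
  refine le_of_sq_le_sq ?_ (by positivity)
  rw [norm_sq_blockOp_apply, mul_pow, PiLp.norm_sq_eq_of_L2]
  exact h _
where
  le_of_sq_le_sq {a b : ℝ} (h : a ^ 2 ≤ b ^ 2) (hb : 0 ≤ b) : a ≤ b :=
    (le_abs_self a).trans (abs_le_of_sq_le_sq h hb)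

theorem norm_blockOp_one (T : Op H) : ‖blockOp fun _ _ : Fin 1 => T‖ = ‖T‖ := by
  refine le_antisymm (norm_blockOp_le (norm_nonneg _) fun v => ?_)
    (T.opNorm_le_bound (norm_nonneg _) fun u => ?_)
  · simpa [← mul_pow] using pow_le_pow_left₀ (norm_nonneg _) (T.le_opNorm (v 0)) 2
  · have := sum_norm_sq_le (fun _ _ : Fin 1 => T) fun _ => u
    simp only [Finset.univ_unique, Finset.sum_singleton, ← mul_pow] at this
    exact (pow_le_pow_iff_left₀ (norm_nonneg _) (by positivity) two_ne_zero).1 this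

variable {P : Submodule ℝ (Op H₀)}

theorem IsCB.exists_nonneg {x : P →ₗ[ℝ] Op H} (hx : IsCB P x) :
    ∃ C : ℝ, 0 ≤ C ∧ ∀ (k : ℕ) (a : Fin k → Fin k → P),
      ‖blockOp fun i j => x (a i j)‖ ≤ C * ‖blockOp fun i j => (a i j : Op H₀)‖ := by
  obtain ⟨C, hC⟩ := hx
  exact ⟨|C|, abs_nonneg C, fun k a => (hC k a).trans (by gcongr; exact le_abs_self C)⟩

theorem IsCB.norm_le {x : P →ₗ[ℝ] Op H} (hx : IsCB P x) : ∃ C : ℝ, ∀ f, ‖x f‖ ≤ C * ‖f‖ := by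
  obtain ⟨C, hC⟩ := hx
  refine ⟨C, fun f => ?_⟩
  have := hC 1 fun _ _ => f
  rwa [norm_blockOp_one, norm_blockOp_one] at this

omit [CompleteSpace E] in
/-- To bound the amplifications of `y` it suffices to control their square sums by those of a
completely bounded map `x`. -/
theorem IsCB.of_sum_norm_sq {x : P →ₗ[ℝ] Op H} (hx : IsCB P x) {y : P →ₗ[ℝ] Op E}
    (h : ∀ (k : ℕ) (a : Fin k → Fin k → P) (M : ℝ),
      (∀ v : Fin k → H, ∑ i, ‖∑ j, x (a i j) (v j)‖ ^ 2 ≤ M * ∑ j, ‖v j‖ ^ 2) → 0 ≤ M →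
      ∀ v : Fin k → E, ∑ i, ‖∑ j, y (a i j) (v j)‖ ^ 2 ≤ M * ∑ j, ‖v j‖ ^ 2) : IsCB P y := by
  obtain ⟨C, hC0, hC⟩ := hx.exists_nonneg
  refine ⟨C, fun k a => norm_blockOp_le (by positivity) fun v => h k a _ (fun v => ?_)
    (by positivity) v⟩
  refine (sum_norm_sq_le _ v).trans ?_
  gcongr
  exact hC k a

theorem IsCB.compress {y : P →ₗ[ℝ] Op F} (hy : IsCB P y) (α : E →ₗᵢ[ℝ] F) :
    IsCB P (compress α y) := by
  refine hy.of_sum_norm_sq fun k a M h hM v => ?_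
  refine le_trans (Finset.sum_le_sum fun i _ => ?_) ((h fun j => α (v j)).trans (by simp))
  simp only [compress_apply, ← map_sum]
  gcongr
  exact norm_adjoint_isometry_le _ _

theorem IsCB.add {x y : P →ₗ[ℝ] Op H} (hx : IsCB P x) (hy : IsCB P y) : IsCB P (x + y) := by
  obtain ⟨C, hC⟩ := hx
  obtain ⟨D, hD⟩ := hy
  refine ⟨C + D, fun k a => ?_⟩
  have : (blockOp fun i j => (x + y) (a i j)) =
      (blockOp fun i j => x (a i j)) + blockOp fun i j => y (a i j) := by
    ext v i
    simp [blockOp_apply, Finset.sum_add_distrib]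
  rw [this, add_mul]
  exact (norm_add_le _ _).trans (add_le_add (hC k a) (hD k a))

/-- The map `α x αᵀ` into `B(F)`, for an isometry `α : E → F` and a map `x` into `B(E)`. -/
def inflate (α : E →ₗᵢ[ℝ] F) (x : P →ₗ[ℝ] Op E) : P →ₗ[ℝ] Op F where
  toFun f := α.toContinuousLinearMap ∘L x f ∘L ContinuousLinearMap.adjoint α.toContinuousLinearMap
  map_add' f g := by ext; simp
  map_smul' c f := by ext; simp

theorem inflate_apply (α : E →ₗᵢ[ℝ] F) (x : P →ₗ[ℝ] Op E) (f : P) (u : F) :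
    inflate α x f u = α (x f (ContinuousLinearMap.adjoint α.toContinuousLinearMap u)) := rfl

theorem IsCB.inflate {x : P →ₗ[ℝ] Op E} (hx : IsCB P x) (α : E →ₗᵢ[ℝ] F) :
    IsCB P (inflate α x) := by
  refine hx.of_sum_norm_sq fun k a M h hM v => ?_
  simp only [inflate_apply, ← map_sum, α.norm_map]
  refine (h _).trans ?_
  gcongr
  exact norm_adjoint_isometry_le _ _

/-- The projection onto the orthogonal complement of the range of an isometry `α`. -/
def complProj (α : E →ₗᵢ[ℝ] F) : Op F :=
  1 - α.toContinuousLinearMap ∘L ContinuousLinearMap.adjoint α.toContinuousLinearMap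

theorem complProj_apply (α : E →ₗᵢ[ℝ] F) (w : F) : complProj α w =
    w - α (ContinuousLinearMap.adjoint α.toContinuousLinearMap w) := rfl

theorem complProj_isometry_apply (α : E →ₗᵢ[ℝ] F) (u : E) : complProj α (α u) = 0 := by
  rw [complProj_apply, adjoint_isometry_apply, sub_self]

theorem norm_complProj_le (α : E →ₗᵢ[ℝ] F) (w : F) : ‖complProj α w‖ ≤ ‖w‖ := by
  refine (pow_le_pow_iff_left₀ (norm_nonneg _) (norm_nonneg _) two_ne_zero).1 ?_
  rw [complProj_apply, norm_sq_sub_adjoint_isometry]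
  nlinarith [sq_nonneg ‖ContinuousLinearMap.adjoint α.toContinuousLinearMap w‖]

theorem lp_sum_apply {ι κ : Type*} (s : Finset κ) (w : κ → lp (fun _ : ι => ℝ) 2) (t : ι) :
    (∑ j ∈ s, w j) t = ∑ j ∈ s, w j t :=
  map_sum (lp.evalₗ (𝕜 := ℝ) (fun _ : ι => ℝ) 2 t) w s

theorem hasSum_sq_lp {ι : Type*} (w : lp (fun _ : ι => ℝ) 2) :
    HasSum (fun t => w t ^ 2) (‖w‖ ^ 2) := by
  have := lp.hasSum_inner (𝕜 := ℝ) w w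
  rw [real_inner_self_eq_norm_sq] at this
  simpa [sq] using this

/-- A bound for a scalar matrix acting on `ℝ^k` also holds for its action on `ℓ²(ι)^k`. -/
theorem sum_norm_sq_scalar_le {ι : Type*} {k : ℕ} {A : Fin k → Fin k → ℝ} {M : ℝ}
    (h : ∀ c : Fin k → ℝ, ∑ i, (∑ j, A i j * c j) ^ 2 ≤ M * ∑ j, c j ^ 2)
    (w : Fin k → lp (fun _ : ι => ℝ) 2) :
    ∑ i, ‖∑ j, A i j • w j‖ ^ 2 ≤ M * ∑ j, ‖w j‖ ^ 2 := by
  have h1 : HasSum (fun t => ∑ i, (∑ j, A i j * w j t) ^ 2) (∑ i, ‖∑ j, A i j • w j‖ ^ 2) := by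
    refine hasSum_sum fun i _ => ?_
    have := hasSum_sq_lp (∑ j, A i j • w j)
    simpa only [lp_sum_apply, lp.coeFn_smul, Pi.smul_apply, smul_eq_mul] using this
  have h2 : HasSum (fun t => M * ∑ j, w j t ^ 2) (M * ∑ j, ‖w j‖ ^ 2) :=
    (hasSum_sum fun j _ => hasSum_sq_lp (w j)).mul_left M
  exact hasSum_le (fun t => h fun j => w j t) h1 h2

/-- The map `f ↦ ζ(f) q`, where `ζ(f)` is the matrix entry of `z f` at the coordinate `t` and
`q` is the projection onto the complement of the range of `α`. -/
def scalarCompl {ι κ : Type*} (z : P →ₗ[ℝ] Op (lp (fun _ : ι => ℝ) 2)) (t : ι)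
    (α : E →ₗᵢ[ℝ] lp (fun _ : κ => ℝ) 2) : P →ₗ[ℝ] Op (lp (fun _ : κ => ℝ) 2) where
  toFun f := (z f (stdVec t) t) • complProj α
  map_add' f g := by simp [add_smul]
  map_smul' c f := by simp [mul_smul]

theorem IsCB.scalarCompl {ι κ : Type*} {z : P →ₗ[ℝ] Op (lp (fun _ : ι => ℝ) 2)} (hz : IsCB P z)
    (t : ι) (α : E →ₗᵢ[ℝ] lp (fun _ : κ => ℝ) 2) : IsCB P (scalarCompl z t α) := by
  refine hz.of_sum_norm_sq fun k a M h hM v => ?_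
  refine (sum_norm_sq_scalar_le (A := fun i j => z (a i j) (stdVec t) t) (M := M) (fun c => ?_)
    (fun j => complProj α (v j))).trans ?_
  · have h1 := h fun j => c j • stdVec t
    simp only [norm_smul, orthonormal_stdVec.1 t, mul_one, Real.norm_eq_abs, sq_abs] at h1
    refine le_trans (Finset.sum_le_sum fun i _ => ?_) h1
    have h2 := lp.norm_apply_le_norm two_ne_zero (∑ j, z (a i j) (c j • stdVec t)) t
    rw [← sq_abs]
    refine pow_le_pow_left₀ (abs_nonneg _) (le_trans (le_of_eq ?_) h2) 2
    rw [lp_sum_apply, Real.norm_eq_abs]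
    simp [mul_comm]
  · gcongr
    exact norm_complProj_le _ _

end CB

theorem hasSum_option {ι M : Type*} [AddCommMonoid M] [TopologicalSpace M] [ContinuousAdd M]
    {f : Option ι → M} {a : M} (h : HasSum (fun i => f (some i)) a) : HasSum f (f none + a) := by
  classical
  have h1 : HasSum (fun o : Option ι => o.elim 0 fun i => f (some i)) a :=
    ((Option.some_injective ι).hasSum_iff (by
      rintro (_ | i) hi
      · rfl
      · exact absurd ⟨i, rfl⟩ hi)).1 h
  have h2 := (hasSum_ite_eq (none : Option ι) (f none)).add h1
  convert h2 using 1
  ext (_ | i) <;> simp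

/-! ### Points of a compact nc convex set -/

section NCPoints

variable {H₀ : Type u} [NormedAddCommGroup H₀] [InnerProductSpace ℝ H₀]
  {P : Submodule ℝ (Op H₀)} {κ : Cardinal.{u}}
  {K : (n : Cardinal.{u}) → Set (P →ₗ[ℝ] Op (Ell2 n))}

/-- The points of `K` on an arbitrary Hilbert space `E`: those maps which an identification of `E`
with some `ℓ²(n)` transports into `K_n`. -/
def PointOn (K : (n : Cardinal.{u}) → Set (P →ₗ[ℝ] Op (Ell2 n))) (E : Type u)
    [NormedAddCommGroup E] [InnerProductSpace ℝ E] [CompleteSpace E] (y : P →ₗ[ℝ] Op E) : Prop :=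
  ∃ (n : Cardinal.{u}) (U : Ell2 n ≃ₗᵢ[ℝ] E), compress U.toLinearIsometry y ∈ K n

variable {E F : Type u} [NormedAddCommGroup E] [InnerProductSpace ℝ E] [CompleteSpace E]
  [NormedAddCommGroup F] [InnerProductSpace ℝ F] [CompleteSpace F]

theorem pointOn_of_mem {n : Cardinal.{u}} {x : P →ₗ[ℝ] Op (Ell2 n)} (hx : x ∈ K n) :
    PointOn K (Ell2 n) x :=
  ⟨n, LinearIsometryEquiv.refl ℝ _, by
    rwa [show (LinearIsometryEquiv.refl ℝ (Ell2 n)).toLinearIsometry = LinearIsometry.id from rfl,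
      compress_id]⟩

theorem PointOn.compress_mem (hK : IsCompactNCConvex P κ K) {y : P →ₗ[ℝ] Op E} (hy : PointOn K E y)
    {m : Cardinal.{u}} (hm : 1 ≤ m) (α : Ell2 m →ₗᵢ[ℝ] E) : compress α y ∈ K m := by
  obtain ⟨n, U, hU⟩ := hy
  refine hK.compression m n (U.symm.toLinearIsometry.comp α) _ _ hm hU
    (isDilation_iff.2 (eq_compress_of_inner fun f u v => ?_))
  simp [inner_compress]

theorem one_le_mk_iff {α : Type u} : 1 ≤ Cardinal.mk α ↔ Nonempty α := by
  rw [Cardinal.one_le_iff_ne_zero, Cardinal.mk_ne_zero_iff]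

theorem nonempty_of_nontrivial_lp {ι : Type*} [Nontrivial (lp (fun _ : ι => ℝ) 2)] :
    Nonempty ι := by
  by_contra h
  rw [not_nonempty_iff] at h
  obtain ⟨a, b, hab⟩ := exists_pair_ne (lp (fun _ : ι => ℝ) 2)
  exact hab (by rw [lp.eq_zero' a, lp.eq_zero' b])

theorem nontrivial_lp {ι : Type*} [h : Nonempty ι] : Nontrivial (lp (fun _ : ι => ℝ) 2) :=
  ⟨⟨stdVec h.some, 0, orthonormal_stdVec.ne_zero _⟩⟩

theorem nontrivial_ell2 {n : Cardinal.{u}} (hn : 1 ≤ n) : Nontrivial (Ell2 n) := by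
  have : Nonempty n.out := by rwa [← one_le_mk_iff, Cardinal.mk_out]
  exact nontrivial_lp

theorem PointOn.nontrivial (hK : IsCompactNCConvex P κ K) {y : P →ₗ[ℝ] Op E}
    (hy : PointOn K E y) : Nontrivial E := by
  obtain ⟨n, U, hU⟩ := hy
  have := nontrivial_ell2 (hK.size n ⟨_, hU⟩).1
  exact U.symm.toEquiv.nontrivial

/-- A Hilbert basis identifies its space with `ℓ²` of the cardinality of the basis. -/
def ell2Equiv {ι : Type u} (b : HilbertBasis ι ℝ E) : Ell2 (Cardinal.mk ι) ≃ₗᵢ[ℝ] E :=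
  (reindexBasis b Cardinal.outMkEquiv).repr.symm

/-- The standard Hilbert basis of `ℓ²(ι)`. -/
def stdBasis (ι : Type*) : HilbertBasis ι ℝ (lp (fun _ : ι => ℝ) 2) :=
  .ofRepr (LinearIsometryEquiv.refl ℝ _)

theorem PointOn.of_compress (hK : IsCompactNCConvex P κ K) {y : P →ₗ[ℝ] Op F}
    (hy : PointOn K F y) (α : E →ₗᵢ[ℝ] F) (hE : Nontrivial E) : PointOn K E (compress α y) := by
  obtain ⟨w, b, -⟩ := exists_hilbertBasis ℝ E
  refine ⟨_, ell2Equiv b, ?_⟩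
  rw [compress_compress]
  refine hy.compress_mem hK ?_ _
  have := (ell2Equiv b).toEquiv.nontrivial
  have := nonempty_of_nontrivial_lp (ι := (Cardinal.mk w).out)
  rwa [← one_le_mk_iff, Cardinal.mk_out] at this

theorem PointOn.bounded (hK : IsCompactNCConvex P κ K) {y : P →ₗ[ℝ] Op E} (hy : PointOn K E y) :
    ∃ C : ℝ, ∀ f, ‖y f‖ ≤ C * ‖f‖ := by
  obtain ⟨n, U, hU⟩ := hy
  obtain ⟨C, hC⟩ := (hK.cb n _ hU).norm_le
  refine ⟨C, fun f => ContinuousLinearMap.opNorm_le_bound _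
    ((norm_nonneg _).trans (hC f)) fun u => ?_⟩
  have h : y f u = U (compress U.toLinearIsometry y f (U.symm u)) := by
    refine ext_inner_right ℝ fun v => ?_
    obtain ⟨v, rfl⟩ := U.surjective v
    rw [U.inner_map_map, inner_compress]
    simp
  rw [h, U.norm_map]
  refine (ContinuousLinearMap.le_opNorm _ _).trans ?_
  rw [U.symm.norm_map]
  gcongr
  exact hC f

/-- Direct sums of points of `K` on an arbitrary Hilbert space. -/
theorem PointOn.directSum (hK : IsCompactNCConvex P κ K) {m : Cardinal.{u}} (U : Ell2 m ≃ₗᵢ[ℝ] E)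
    (h1 : 1 ≤ m) (hm : m ≤ κ) {ι : Type u}
    (d : ι → Σ n : Cardinal.{u}, (P →ₗ[ℝ] Op (Ell2 n)) × (Ell2 n →ₗᵢ[ℝ] E))
    (hd : ∀ i, (d i).2.1 ∈ K (d i).1) {X : P →ₗ[ℝ] Op E} (hX : IsCB P X)
    (hsum : ∀ h : E, HasSum (fun i => (d i).2.2
      (ContinuousLinearMap.adjoint (d i).2.2.toContinuousLinearMap h)) h)
    (hXsum : ∀ (f : P) (h : E), HasSum (fun i => (d i).2.2 ((d i).2.1 f
      (ContinuousLinearMap.adjoint (d i).2.2.toContinuousLinearMap h))) (X f h)) :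
    PointOn K E X := by
  have hadj : ∀ i h, ContinuousLinearMap.adjoint
      (U.symm.toLinearIsometry.comp (d i).2.2).toContinuousLinearMap h =
      ContinuousLinearMap.adjoint (d i).2.2.toContinuousLinearMap (U h) := by
    intro i h
    refine ext_inner_right ℝ fun v => ?_
    rw [ContinuousLinearMap.adjoint_inner_left, ContinuousLinearMap.adjoint_inner_left,
      ← U.inner_map_map]
    simp
  have hUX : ∀ f h, compress U.toLinearIsometry X f h = U.symm (X f (U h)) := by
    intro f h
    refine ext_inner_right ℝ fun v => ?_
    rw [inner_compress, ← U.inner_map_map (U.symm _) v, U.apply_symm_apply]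
    rfl
  refine ⟨m, U, hK.directSum m ι (fun i => (d i).1) (fun i => (d i).2.1)
    (fun i => U.symm.toLinearIsometry.comp (d i).2.2) _ h1 hm hd (fun h => ?_)
    (hX.compress _) fun f h => ?_⟩
  · have := (hsum (U h)).mapL U.symm.toContinuousLinearEquiv.toContinuousLinearMap
    simpa [hadj] using this
  · have := (hXsum f (U h)).mapL U.symm.toContinuousLinearEquiv.toContinuousLinearMap
    simpa [hadj, hUX] using this

/-- The direct sum of a point on the range of an isometry and of copies of a point of `K_1`. -/
theorem PointOn.directSum_option (hK : IsCompactNCConvex P κ K) {m : Cardinal.{u}}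
    (U : Ell2 m ≃ₗᵢ[ℝ] E) (h1 : 1 ≤ m) (hm : m ≤ κ) {n : Cardinal.{u}} {x : P →ₗ[ℝ] Op (Ell2 n)}
    (hx : x ∈ K n) (α : Ell2 n →ₗᵢ[ℝ] E) {z : P →ₗ[ℝ] Op (Ell2 1)} (hz : z ∈ K 1) {ι : Type u}
    (γ : ι → Ell2 1 →ₗᵢ[ℝ] E) {X : P →ₗ[ℝ] Op E} (hX : IsCB P X)
    (hsum : ∀ h : E, HasSum (fun i => γ i
      (ContinuousLinearMap.adjoint (γ i).toContinuousLinearMap h)) (complProj α h))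
    (hXsum : ∀ (f : P) (h : E), HasSum (fun i => γ i (z f
      (ContinuousLinearMap.adjoint (γ i).toContinuousLinearMap h)))
      (X f h - α (x f (ContinuousLinearMap.adjoint α.toContinuousLinearMap h)))) :
    PointOn K E X := by
  let d : Option ι → Σ n : Cardinal.{u}, (P →ₗ[ℝ] Op (Ell2 n)) × (Ell2 n →ₗᵢ[ℝ] E)
    | none => ⟨n, x, α⟩
    | some i => ⟨1, z, γ i⟩
  refine PointOn.directSum hK U h1 hm d ?_ hX (fun h => ?_) fun f h => ?_
  · rintro (_ | i)
    exacts [hx, hz]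
  · have := hasSum_option (f := fun i => (d i).2.2
      (ContinuousLinearMap.adjoint (d i).2.2.toContinuousLinearMap h)) (hsum h)
    rwa [complProj_apply, add_sub_cancel] at this
  · let g : Option ι → E := fun o => o.elim
      (α (x f (ContinuousLinearMap.adjoint α.toContinuousLinearMap h)))
      fun i => γ i (z f (ContinuousLinearMap.adjoint (γ i).toContinuousLinearMap h))
    have hg : HasSum g (g none + (X f h - g none)) := hasSum_option (f := g) (hXsum f h)
    rw [add_sub_cancel] at hg
    convert hg using 1
    funext o
    cases o <;> rfl

theorem adjoint_incl_stdVec_of_notMem {Λ : Type u} {S T : Set Λ} (hST : S ⊆ T) {t : T}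
    (ht : t.1 ∉ S) :
    ContinuousLinearMap.adjoint (incl hST).toContinuousLinearMap (stdVec t) = 0 := by
  refine ext_inner_right ℝ fun v => ?_
  rw [ContinuousLinearMap.adjoint_inner_left, inner_zero_left]
  have h : (innerSL ℝ (stdVec t)).comp (incl hST).toContinuousLinearMap = 0 :=
    clm_ext_stdVec fun s => by
      change ⟪stdVec t, incl hST (stdVec s)⟫_ℝ = 0
      rw [incl_stdVec]
      exact orthonormal_stdVec.2 fun e => ht (e ▸ s.2)
  exact DFunLike.congr_fun h v

theorem complProj_incl_apply {Λ : Type u} {S T : Set Λ} (hST : S ⊆ T) (h : L2 T) (t : T)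
    [Decidable (t.1 ∈ S)] : complProj (incl hST) h t = if t.1 ∈ S then 0 else h t := by
  have h3 : ⟪incl hST (ContinuousLinearMap.adjoint (incl hST).toContinuousLinearMap h),
      stdVec t⟫_ℝ =
      ⟪h, incl hST
        (ContinuousLinearMap.adjoint (incl hST).toContinuousLinearMap (stdVec t))⟫_ℝ := by
    have e : ∀ w, incl hST w = (incl hST).toContinuousLinearMap w := fun _ => rfl
    rw [e, e, ← ContinuousLinearMap.adjoint_inner_right, ContinuousLinearMap.adjoint_inner_left]
  rw [← inner_stdVec, complProj_apply, inner_sub_left, inner_stdVec h, h3]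
  by_cases ht : t.1 ∈ S
  · have h4 : stdVec t = incl hST (stdVec ⟨t.1, ht⟩) := (incl_stdVec hST ⟨t.1, ht⟩).symm
    rw [if_pos ht, h4, adjoint_isometry_apply, ← h4, inner_stdVec, sub_self]
  · rw [if_neg ht, adjoint_incl_stdVec_of_notMem hST ht, map_zero, inner_zero_right, sub_zero]

theorem hasSum_complProj_incl {Λ : Type u} {S T : Set Λ} (hST : S ⊆ T) (h : L2 T) :
    HasSum (fun t : {t : T // t.1 ∉ S} => h t • stdVec t.1) (complProj (incl hST) h) := by
  classical
  have hs := (hasSum_subtype_iff_of_support_subset (s := {t : T | t.1 ∉ S}) (fun t ht hS => ht (by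
    rw [complProj_incl_apply, if_pos hS, zero_smul]))).2 (hasSum_stdVec (complProj (incl hST) h))
  have e : (fun t : {t : T // t.1 ∉ S} => h t • stdVec t.1) =
      fun t : {t : T // t.1 ∉ S} => complProj (incl hST) h t.1 • stdVec t.1 := by
    funext t
    rw [complProj_incl_apply, if_neg t.2]
  rw [e]
  exact hs

theorem PointOn.isCB (hK : IsCompactNCConvex P κ K) {y : P →ₗ[ℝ] Op E} (hy : PointOn K E y) :
    IsCB P y := by
  obtain ⟨n, U, hU⟩ := hy
  have := (hK.cb n _ hU).compress U.symm.toLinearIsometry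
  rw [compress_compress] at this
  convert this using 1
  exact eq_compress_of_inner fun f u v => by simp

/-- A nonempty compact nc convex set has a point on every `ℓ²(T)` with `|T| ≤ κ` that dilates a
given point on `ℓ²(S)`, `S ⊆ T`: add a direct sum of copies of a point of `K_1`. -/
theorem PointOn.exists_pad (hK : IsCompactNCConvex P κ K) {Λ : Type u} {S T : Set Λ} (hST : S ⊆ T)
    (hT : Cardinal.mk T ≤ κ) {y : P →ₗ[ℝ] Op (L2 S)} (hy : PointOn K (L2 S) y) :
    ∃ X : P →ₗ[ℝ] Op (L2 T), PointOn K (L2 T) X ∧ y = compress (incl hST) X := by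
  have := hy.nontrivial hK
  obtain ⟨s₀⟩ : Nonempty S := nonempty_of_nontrivial_lp
  have hTne : Nonempty T := ⟨⟨s₀, hST s₀.2⟩⟩
  obtain ⟨hsub, ⟨t₀⟩⟩ := Cardinal.eq_one_iff_unique.1 (Cardinal.mk_out (1 : Cardinal.{u}))
  have hconst : ∀ {G : Type u} [NormedAddCommGroup G] [InnerProductSpace ℝ G] (v : G), ‖v‖ = 1 →
      Orthonormal ℝ fun _ : (1 : Cardinal.{u}).out => v := fun v hv =>
    ⟨fun _ => hv, fun i j hij => absurd (Subsingleton.elim i j) hij⟩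
  let z : P →ₗ[ℝ] Op (Ell2 1) :=
    compress (ofOrthonormal (hconst (stdVec s₀) (orthonormal_stdVec.1 _))) y
  have hz : z ∈ K 1 := hy.compress_mem hK le_rfl _
  have hze : ∀ w : Ell2 1, w = w t₀ • stdVec t₀ := by
    intro w
    ext t
    rw [Subsingleton.elim t t₀]
    simp [stdVec]
  obtain ⟨n, U, hU⟩ := id hy
  let γ : T → Ell2 1 →ₗᵢ[ℝ] L2 T := fun t =>
    ofOrthonormal (hconst (stdVec t) (orthonormal_stdVec.1 _))
  have hγe : ∀ t : T, γ t (stdVec t₀) = stdVec t := fun t => ofOrthonormal_stdVec _ _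
  have hγ : ∀ t (w : L2 T), ContinuousLinearMap.adjoint (γ t).toContinuousLinearMap w =
      w t • stdVec t₀ := by
    intro t w
    refine (hze _).trans ?_
    congr 1
    rw [← inner_stdVec, ContinuousLinearMap.adjoint_inner_left, ← inner_stdVec w]
    exact congrArg (fun v => ⟪w, v⟫_ℝ) (hγe t)
  let X : P →ₗ[ℝ] Op (L2 T) := inflate (incl hST) y + scalarCompl z t₀ (incl hST)
  have hXCB : IsCB P X :=
    ((hy.isCB hK).inflate _).add ((hK.cb 1 _ hz).scalarCompl t₀ _)
  have hUadj : ∀ h, U (ContinuousLinearMap.adjoint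
      ((incl hST).comp U.toLinearIsometry).toContinuousLinearMap h) =
      ContinuousLinearMap.adjoint (incl hST).toContinuousLinearMap h := by
    intro h
    refine ext_inner_right ℝ fun v => ?_
    obtain ⟨v, rfl⟩ := U.surjective v
    rw [U.inner_map_map, ContinuousLinearMap.adjoint_inner_left,
      ContinuousLinearMap.adjoint_inner_left]
    rfl
  have hyU : ∀ f w, U (compress U.toLinearIsometry y f w) = y f (U w) := by
    intro f w
    refine ext_inner_right ℝ fun v => ?_
    obtain ⟨v, rfl⟩ := U.surjective v
    rw [U.inner_map_map, inner_compress]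
    rfl
  refine ⟨X, PointOn.directSum_option hK (ell2Equiv (stdBasis T)) (one_le_mk_iff.2 hTne) hT hU
    ((incl hST).comp U.toLinearIsometry) hz (fun t : {t : T // t.1 ∉ S} => γ t) hXCB
    (fun h => ?_) (fun f h => ?_), ?_⟩
  · have e : complProj ((incl hST).comp U.toLinearIsometry) h = complProj (incl hST) h := by
      rw [complProj_apply, complProj_apply, ← hUadj]
      rfl
    simp only [hγ, map_smul, hγe, e]
    exact hasSum_complProj_incl hST h
  · have e : X f h - (incl hST).comp U.toLinearIsometry (compress U.toLinearIsometry y f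
        (ContinuousLinearMap.adjoint
          ((incl hST).comp U.toLinearIsometry).toContinuousLinearMap h)) =
        (z f (stdVec t₀) t₀) • complProj (incl hST) h := by
      have e1 : X f h = incl hST (y f (ContinuousLinearMap.adjoint
          (incl hST).toContinuousLinearMap h)) +
          (z f (stdVec t₀) t₀) • complProj (incl hST) h := rfl
      rw [e1, ← hUadj, ← hyU]
      exact add_sub_cancel_left _ _
    rw [e]
    have e2 : (fun t : {t : T // t.1 ∉ S} => γ t (z f
        (ContinuousLinearMap.adjoint (γ t).toContinuousLinearMap h))) =
        fun t : {t : T // t.1 ∉ S} => (z f (stdVec t₀) t₀) • h t • stdVec t.1 := by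
      funext t
      rw [hγ, map_smul, map_smul, hze (z f (stdVec t₀)), map_smul, hγe, smul_comm, ← hze]
    rw [e2]
    exact (hasSum_complProj_incl hST h).const_smul _
  · refine eq_compress_of_inner fun f u v => ?_
    have e1 : X f (incl hST u) = incl hST (y f (ContinuousLinearMap.adjoint
        (incl hST).toContinuousLinearMap (incl hST u))) +
        (z f (stdVec t₀) t₀) • complProj (incl hST) (incl hST u) := rfl
    rw [e1, adjoint_isometry_apply, complProj_isometry_apply, smul_zero, add_zero,
      LinearIsometry.inner_map_map]

omit [CompleteSpace E] in
theorem continuous_pointWeakStar_inner (f : P) (u v : E) :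
    @Continuous _ _ (pointWeakStar P E) _ fun x : P →ₗ[ℝ] Op E => ⟪x f u, v⟫_ℝ := by
  classical
  let := pointWeakStar P E
  have h := (continuous_apply ((f, lp.single 2 0 u, lp.single 2 0 v) :
    P × lp (fun _ : ℕ => E) 2 × lp (fun _ : ℕ => E) 2)).comp
    (continuous_induced_dom (f := fun (x : P →ₗ[ℝ] Op E)
      (t : P × lp (fun _ : ℕ => E) 2 × lp (fun _ : ℕ => E) 2) =>
      ∑' k : ℕ, ⟪x t.1 (t.2.1 k), t.2.2 k⟫_ℝ))
  convert h using 1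
  ext x
  simp only [Function.comp_apply]
  rw [tsum_eq_single 0]
  · simp
  · intro k hk
    simp [hk]

/-- The points of a compact nc convex set form a dilation class: limits of chains exist by
compactness, applied after padding all members of the chain to maps on the same space. -/
theorem isDilationClass_pointOn (hK : IsCompactNCConvex P κ K) :
    IsDilationClass P κ (fun E _ _ _ y => PointOn K E y) where
  compress E F _ _ _ _ _ _ α y hy hn := hy.of_compress hK α (hn (hy.nontrivial hK))
  bounded E _ _ _ y hy := hy.bounded hK
  limit := by
    intro Λ I _ _ _ S hS y hcomp hcard hy
    choose X hX hyX using fun i => (hy i).exists_pad hK (Set.subset_iUnion S i) hcard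
    have i₀ : I := Classical.arbitrary I
    have := (hX i₀).nontrivial hK
    have hne : Nonempty (⋃ i, S i : Set Λ) := nonempty_of_nontrivial_lp
    let U : Ell2 (Cardinal.mk (⋃ i, S i : Set Λ)) ≃ₗᵢ[ℝ] L2 (⋃ i, S i) := ell2Equiv (stdBasis _)
    let 𝒰 : Ultrafilter I := Ultrafilter.of Filter.atTop
    have h𝒰 : (𝒰 : Filter I) ≤ Filter.atTop := Ultrafilter.of_le _
    let x : I → (P →ₗ[ℝ] Op (Ell2 (Cardinal.mk (⋃ i, S i : Set Λ)))) := fun i =>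
      compress U.toLinearIsometry (X i)
    have hx : ∀ i, x i ∈ K _ := fun i => (hX i).compress_mem hK (one_le_mk_iff.2 hne) _
    let := pointWeakStar P (Ell2 (Cardinal.mk (⋃ i, S i : Set Λ)))
    obtain ⟨x', hx', hlim⟩ := (hK.compact (Cardinal.mk (⋃ i, S i : Set Λ))).ultrafilter_le_nhds'
      (𝒰.map x) (Ultrafilter.mem_map.2 (Filter.univ_mem' hx))
    refine ⟨compress U.symm.toLinearIsometry x', ⟨_, U, ?_⟩, fun i =>
      eq_compress_of_inner fun f u v => ?_⟩
    · rw [compress_compress]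
      convert hx'
      exact (eq_compress_of_inner fun f u v => by simp).symm
    · rw [inner_compress]
      have h1 : Filter.Tendsto (fun j => ⟪x j f (U.symm (incl (Set.subset_iUnion S i) u)),
          U.symm (incl (Set.subset_iUnion S i) v)⟫_ℝ) 𝒰 (nhds ⟪x' f (U.symm
            (incl (Set.subset_iUnion S i) u)), U.symm (incl (Set.subset_iUnion S i) v)⟫_ℝ) :=
        ((continuous_pointWeakStar_inner f _ _).tendsto x').comp hlim
      refine tendsto_nhds_unique (tendsto_const_nhds.congr' ?_) h1
      filter_upwards [h𝒰 (Filter.mem_atTop i)] with j hj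
      have hj' : i ≤ j := hj
      rw [hcomp i j hj', inner_compress, hyX j, inner_compress, inner_compress,
        ← incl_comp_incl (hS hj') (Set.subset_iUnion S j)]
      simp

theorem exists_maximalPoint (hκ : Cardinal.aleph0 ≤ κ)
    (hP : ∃ S : Set P, Dense S ∧ Cardinal.mk S ≤ κ) (hK : IsCompactNCConvex P κ K)
    {n : Cardinal.{u}} {x : P →ₗ[ℝ] Op (Ell2 n)} (hx : x ∈ K n) :
    ∃ (m : Cardinal.{u}) (y : P →ₗ[ℝ] Op (Ell2 m)) (α : Ell2 n →ₗᵢ[ℝ] Ell2 m),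
      IsMaximalPoint K y ∧ IsDilation α y x := by
  obtain ⟨D, hDd, hD⟩ := hP
  obtain ⟨F, _, _, _, y, α, ⟨m, U, hU⟩, hxy, hmax⟩ :=
    exists_maximal_dilation (isDilationClass_pointOn hK) hκ hDd hD (stdBasis n.out)
      (by rw [Cardinal.mk_out]; exact (hK.size n ⟨x, hx⟩).2) (pointOn_of_mem hx)
  refine ⟨m, compress U.toLinearIsometry y, U.symm.toLinearIsometry.comp α, ⟨hU, ?_⟩,
    isDilation_iff.2 ?_⟩
  · intro m' z β hz hβ f
    have h := hmax (Ell2 m') z (β.comp U.symm.toLinearIsometry) (pointOn_of_mem hz) (by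
      rw [← compress_compress, ← isDilation_iff.1 hβ, compress_compress]
      exact eq_compress_of_inner fun f u v => by simp) f
    convert h using 1
    refine ContinuousLinearMap.ext fun w => ?_
    have e : ∀ w, β (ContinuousLinearMap.adjoint β.toContinuousLinearMap w) =
        (β.comp U.symm.toLinearIsometry) (ContinuousLinearMap.adjoint
          (β.comp U.symm.toLinearIsometry).toContinuousLinearMap w) := by
      intro w
      change _ = β (U.symm _)
      congr 1
      refine ext_inner_right ℝ fun v => ?_
      rw [ContinuousLinearMap.adjoint_inner_left, ← U.inner_map_map (U.symm _) v,
        U.apply_symm_apply, ContinuousLinearMap.adjoint_inner_left]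
      simp
    exact e w
  · rw [hxy, compress_compress]
    exact eq_compress_of_inner fun f u v => by simp [inner_compress]

end NCPoints

/-! ### Maximal dilations of ucp maps -/

section UCP

variable {H₀ : Type*} [NormedAddCommGroup H₀] [InnerProductSpace ℝ H₀]
  {E F : Type*} [NormedAddCommGroup E] [InnerProductSpace ℝ E] [CompleteSpace E]
  [NormedAddCommGroup F] [InnerProductSpace ℝ F] [CompleteSpace F]
  {V : Submodule ℝ (Op H₀)}

omit [CompleteSpace E] in
theorem isUCP_of_posMat {y : V →ₗ[ℝ] Op E} (h1 : ∀ v : V, (v : Op H₀) = 1 → y v = 1)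
    (h2 : ∀ (k : ℕ) (a : Fin k → Fin k → V), PosMat (fun i j => (a i j : Op H₀)) →
      PosMat fun i j => y (a i j)) : IsUCP V y :=
  ⟨h1, fun k a ha => (isPositive_blockOp_iff _).2 (h2 k a ((isPositive_blockOp_iff _).1 ha))⟩

theorem IsUCP.compress {y : V →ₗ[ℝ] Op F} (hy : IsUCP V y) (α : E →ₗᵢ[ℝ] F) :
    IsUCP V (compress α y) := by
  refine isUCP_of_posMat (fun v hv => ?_) fun k a ha => ?_
  · ext u
    rw [compress_apply, hy.unital v hv]
    exact adjoint_isometry_apply α u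
  · have h := hy.posMat ha
    refine ⟨fun i j u w => ?_, fun v => ?_⟩
    · rw [inner_compress, h.1, real_inner_comm _ u, inner_compress, real_inner_comm]
    · simpa only [inner_compress] using h.2 fun i => α (v i)

theorem inner_inflate (α : E →ₗᵢ[ℝ] F) (x : V →ₗ[ℝ] Op E) (f : V) (u v : F) :
    ⟪inflate α x f u, v⟫_ℝ = ⟪x f (ContinuousLinearMap.adjoint α.toContinuousLinearMap u),
      ContinuousLinearMap.adjoint α.toContinuousLinearMap v⟫_ℝ := by
  rw [ContinuousLinearMap.adjoint_inner_right]
  rfl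

/-- Uniformly bounded linear maps into `B(E)` converge along ultrafilters in the point-weak
sense. -/
theorem exists_weak_limit {I : Type*} (𝒰 : Ultrafilter I) (X : I → V →ₗ[ℝ] Op E)
    (hX : ∀ i f, ‖X i f‖ ≤ ‖f‖) :
    ∃ z : V →ₗ[ℝ] Op E, ∀ f u v,
      Filter.Tendsto (fun i => ⟪X i f u, v⟫_ℝ) 𝒰 (nhds ⟪z f u, v⟫_ℝ) := by
  have hb : ∀ f u v i, |⟪X i f u, v⟫_ℝ| ≤ ‖f‖ * ‖u‖ * ‖v‖ := fun f u v i =>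
    (abs_real_inner_le_norm _ _).trans (by
      gcongr
      exact ((X i f).le_opNorm u).trans (by gcongr; exact hX i f))
  have hex : ∀ f u v, ∃ l ∈ Set.Icc (-(‖f‖ * ‖u‖ * ‖v‖)) (‖f‖ * ‖u‖ * ‖v‖),
      Filter.Tendsto (fun i => ⟪X i f u, v⟫_ℝ) 𝒰 (nhds l) := fun f u v =>
    isCompact_Icc.ultrafilter_le_nhds' (𝒰.map fun i => ⟪X i f u, v⟫_ℝ)
      (Ultrafilter.mem_map.2 (Filter.univ_mem' fun i => abs_le.1 (hb f u v i)))
  choose l hl hlim using hex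
  have hladd : ∀ f u v v', l f u (v + v') = l f u v + l f u v' := fun f u v v' =>
    tendsto_nhds_unique (hlim f u (v + v'))
      (by simpa [inner_add_right] using (hlim f u v).add (hlim f u v'))
  have hlsmul : ∀ f u (c : ℝ) v, l f u (c • v) = c * l f u v := fun f u c v =>
    tendsto_nhds_unique (hlim f u (c • v))
      (by simpa [real_inner_smul_right] using (hlim f u v).const_mul c)
  let L : V → E → StrongDual ℝ E := fun f u => LinearMap.mkContinuous
    { toFun := l f u
      map_add' := hladd f u
      map_smul' := hlsmul f u } (‖f‖ * ‖u‖) fun v => abs_le.2 (hl f u v)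
  let w : V → E → E := fun f u => (InnerProductSpace.toDual ℝ E).symm (L f u)
  have hw : ∀ f u v, ⟪w f u, v⟫_ℝ = l f u v := fun f u v =>
    InnerProductSpace.toDual_symm_apply
  have hnorm : ∀ f u, ‖w f u‖ ≤ ‖f‖ * ‖u‖ := fun f u => by
    rw [LinearIsometryEquiv.norm_map]
    exact LinearMap.mkContinuous_norm_le _ (by positivity) _
  have htends : ∀ f u v, Filter.Tendsto (fun i => ⟪X i f u, v⟫_ℝ) 𝒰 (nhds ⟪w f u, v⟫_ℝ) :=
    fun f u v => by rw [hw]; exact hlim f u v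
  let z : V →ₗ[ℝ] Op E :=
    { toFun := fun f => LinearMap.mkContinuous
        { toFun := w f
          map_add' := fun u u' => ext_inner_right ℝ fun v =>
            tendsto_nhds_unique (htends f (u + u') v)
              (by simpa [inner_add_left] using (htends f u v).add (htends f u' v))
          map_smul' := fun c u => ext_inner_right ℝ fun v =>
            tendsto_nhds_unique (htends f (c • u) v)
              (by simpa [real_inner_smul_left] using (htends f u v).const_mul c) }
        ‖f‖ (hnorm f)
      map_add' := fun f g => ContinuousLinearMap.ext fun u => ext_inner_right ℝ fun v =>
        tendsto_nhds_unique (htends (f + g) u v)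
          (by simpa [inner_add_left] using (htends f u v).add (htends g u v))
      map_smul' := fun c f => ContinuousLinearMap.ext fun u => ext_inner_right ℝ fun v =>
        tendsto_nhds_unique (htends (c • f) u v)
          (by simpa [real_inner_smul_left] using (htends f u v).const_mul c) }
  exact ⟨z, htends⟩

end UCP

section MaximalUCP

variable {H₀ : Type u} [NormedAddCommGroup H₀] [InnerProductSpace ℝ H₀] [CompleteSpace H₀]
  {V : Submodule ℝ (Op H₀)}

/-- The ucp maps on an operator system form a dilation class. -/
theorem isDilationClass_ucp (hV : IsOperatorSystem V) (κ : Cardinal.{u}) :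
    IsDilationClass V κ (fun _ _ _ _ y => IsUCP V y) where
  compress E F _ _ _ _ _ _ α y hy _ := hy.compress α
  bounded E _ _ _ y hy := ⟨1, fun f => by rw [one_mul]; exact hy.norm_le hV f⟩
  limit := by
    intro Λ I _ _ _ S hS y hcomp _ hy
    let J : ∀ i, L2 (S i) →ₗᵢ[ℝ] L2 (⋃ i, S i) := fun i => incl (Set.subset_iUnion S i)
    let 𝒰 : Ultrafilter I := Ultrafilter.of Filter.atTop
    have h𝒰 : (𝒰 : Filter I) ≤ Filter.atTop := Ultrafilter.of_le _
    obtain ⟨z, hz⟩ := exists_weak_limit 𝒰 (fun i => inflate (J i) (y i)) fun i f => by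
      refine ContinuousLinearMap.opNorm_le_bound _ (norm_nonneg _) fun u => ?_
      rw [inflate_apply, (J i).norm_map]
      refine (ContinuousLinearMap.le_opNorm _ _).trans ?_
      gcongr
      · exact (hy i).norm_le hV f
      · exact norm_adjoint_isometry_le _ _
    simp only [inner_inflate] at hz
    have hadj : ∀ {i j} (h : i ≤ j) u,
        ContinuousLinearMap.adjoint (J j).toContinuousLinearMap (J i u) = incl (hS h) u := by
      intro i j h u
      have : J i u = J j (incl (hS h) u) :=
        (DFunLike.congr_fun (incl_comp_incl (hS h) (Set.subset_iUnion S j)) u).symm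
      rw [this, adjoint_isometry_apply]
    refine ⟨z, isUCP_of_posMat (fun v hv => clm_ext_stdVec fun s => ?_) fun k a ha => ⟨?_, ?_⟩,
      fun i => eq_compress_of_inner fun f u v => ?_⟩
    · refine ext_inner_right ℝ fun w => tendsto_nhds_unique (hz v (stdVec s) w) ?_
      obtain ⟨i, hi⟩ := Set.mem_iUnion.1 s.2
      refine tendsto_const_nhds.congr' ?_
      filter_upwards [h𝒰 (Filter.mem_atTop i)] with j hj
      have hj' : i ≤ j := hj
      have h1 : stdVec s = J i (stdVec ⟨s, hi⟩) :=
        (incl_stdVec (Set.subset_iUnion S i) ⟨s.1, hi⟩).symm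
      rw [(hy j).unital v hv, one_apply_eq_self, one_apply_eq_self,
        ContinuousLinearMap.adjoint_inner_right, h1, hadj hj']
      exact congrArg (fun t => ⟪t, w⟫_ℝ)
        (DFunLike.congr_fun (incl_comp_incl (hS hj') (Set.subset_iUnion S j)) _).symm
    · intro i j u w
      refine tendsto_nhds_unique (hz (a i j) u w) ?_
      have e : ⟪u, z (a j i) w⟫_ℝ = ⟪z (a j i) w, u⟫_ℝ := real_inner_comm _ _
      rw [e]
      refine (hz (a j i) w u).congr fun l => ?_
      rw [real_inner_comm]
      exact (((hy l).posMat ha).1 i j _ _).symm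
    · intro v
      refine ge_of_tendsto' (tendsto_finsetSum _ fun i _ => tendsto_finsetSum _ fun j _ =>
        hz (a i j) (v j) (v i)) fun l => ?_
      exact ((hy l).posMat ha).2 fun i =>
        ContinuousLinearMap.adjoint (J l).toContinuousLinearMap (v i)
    · refine tendsto_nhds_unique (tendsto_const_nhds.congr' ?_) (hz f (J i u) (J i v))
      filter_upwards [h𝒰 (Filter.mem_atTop i)] with j hj
      have hj' : i ≤ j := hj
      rw [hadj hj', hadj hj', hcomp i j hj', inner_compress]

theorem exists_maximalUCP (hV : IsOperatorSystem V) {H : Type u} [NormedAddCommGroup H]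
    [InnerProductSpace ℝ H] [CompleteSpace H] {φ : V →ₗ[ℝ] Op H} (hφ : IsUCP V φ) :
    ∃ (L : Type u) (_ : NormedAddCommGroup L) (_ : InnerProductSpace ℝ L)
      (_ : CompleteSpace L) (π : V →ₗ[ℝ] Op L) (α : H →ₗᵢ[ℝ] L),
      IsDilation α π φ ∧ IsMaximalUCP V π := by
  obtain ⟨w, b, -⟩ := exists_hilbertBasis ℝ H
  let κ : Cardinal.{u} := max Cardinal.aleph0 (max (Cardinal.mk V) (Cardinal.mk w))
  obtain ⟨L, i1, i2, i3, π, α, hπ, hφπ, hmax⟩ :=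
    exists_maximal_dilation (isDilationClass_ucp hV κ) (le_max_left _ _)
      (D := Set.univ) dense_univ (by
        rw [Cardinal.mk_univ]
        exact (le_max_left _ _).trans (le_max_right _ _)) b
      ((le_max_right _ _).trans (le_max_right _ _)) hφ
  exact ⟨L, i1, i2, i3, π, α, isDilation_iff.2 hφπ, hπ, fun L' _ _ _ ψ β hψ hβ =>
    hmax L' ψ β hψ (isDilation_iff.1 hβ)⟩

end MaximalUCP

/-! ### Extension of ucp maps -/

section Extension

variable {H₀ : Type*} [NormedAddCommGroup H₀] [InnerProductSpace ℝ H₀]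
  {H L : Type*} [NormedAddCommGroup H] [InnerProductSpace ℝ H]
  [NormedAddCommGroup L] [InnerProductSpace ℝ L] {X : Type*}
  {V : Submodule ℝ (Op H₀)}

theorem IsUCOE.posMat_of_map {j : V →ₗ[ℝ] Op H} (hj : IsUCOE V j) {ι : Type*} [Fintype ι]
    {a : ι → ι → V} (ha : PosMat fun i l => j (a i l)) : PosMat fun i l => (a i l : Op H₀) := by
  have h1 := hj.reflects _
    (fun i l => a ((Fintype.equivFin ι).symm i) ((Fintype.equivFin ι).symm l))
    ((isPositive_blockOp_iff _).2 (ha.reindex (Fintype.equivFin ι).symm))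
  simpa using ((isPositive_blockOp_iff _).1 h1).reindex (Fintype.equivFin ι)

theorem lsum_eq_sum_coe {M : Type*} [AddCommGroup M] [Module ℝ M] (Φ : X × X → M →ₗ[ℝ] ℝ)
    (y : X × X →₀ M) {s : Finset X} (hs : y.support ⊆ s ×ˢ s) :
    Finsupp.lsum ℝ Φ y = ∑ i : s, ∑ j : s, Φ (i, j) (y (i, j)) := by
  rw [Finsupp.lsum_apply, Finsupp.sum_of_support_subset _ hs _ (by simp), Finset.sum_product]
  rw [← Finset.sum_coe_sort s]
  refine Finset.sum_congr rfl fun i _ => ?_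
  rw [← Finset.sum_coe_sort s]

theorem exists_support_subset {M : Type*} [Zero M] (y : X × X →₀ M) :
    ∃ s : Finset X, y.support ⊆ s ×ˢ s := by
  classical
  refine ⟨y.support.image Prod.fst ∪ y.support.image Prod.snd, fun p hp => ?_⟩
  exact Finset.mem_product.2 ⟨Finset.mem_union_left _ (Finset.mem_image_of_mem _ hp),
    Finset.mem_union_right _ (Finset.mem_image_of_mem _ hp)⟩

/-- The functional `⟪·η, ξ⟫` on `B(H)`. -/
def matrixCoeff (η ξ : H) : Op H →ₗ[ℝ] ℝ where
  toFun b := ⟪b η, ξ⟫_ℝ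
  map_add' b c := by simp [inner_add_left]
  map_smul' r b := by simp [real_inner_smul_left]

theorem matrixCoeff_apply (η ξ : H) (b : Op H) : matrixCoeff η ξ b = ⟪b η, ξ⟫_ℝ := rfl

/-- The quadratic form of a finitely supported operator matrix `y`, indexed by `X`, at a family `v`
of vectors: `∑ ⟪y (ξ, η) (v η), v ξ⟫`. -/
def quadForm (v : X → H) : (X × X →₀ Op H) →ₗ[ℝ] ℝ :=
  Finsupp.lsum ℝ fun p => matrixCoeff (v p.2) (v p.1)

theorem quadForm_single (v : X → H) (ξ η : X) (b : Op H) :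
    quadForm v (Finsupp.single (ξ, η) b) = ⟪b (v η), v ξ⟫_ℝ := by
  simp [quadForm, matrixCoeff_apply]

/-- The finitely supported operator matrices with nonnegative quadratic form. They need not be
self-adjoint: over the reals, skew-adjoint matrices have zero quadratic form. -/
def nonnegCone (H X : Type*) [NormedAddCommGroup H] [InnerProductSpace ℝ H] :
    PointedCone ℝ (X × X →₀ Op H) where
  carrier := {y | ∀ v : X → H, 0 ≤ quadForm v y}
  add_mem' {x y} hx hy v := by
    rw [map_add]
    exact add_nonneg (hx v) (hy v)
  zero_mem' v := by simp
  smul_mem' c y hy v := by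
    have : quadForm v (c • y) = (c : ℝ) * quadForm v y := by
      rw [← smul_eq_mul, ← map_smul]
      rfl
    rw [this]
    exact mul_nonneg c.2 (hy v)

theorem mem_nonnegCone {y : X × X →₀ Op H} :
    y ∈ nonnegCone H X ↔ ∀ v : X → H, 0 ≤ quadForm v y := Iff.rfl

theorem exists_add_mem_nonnegCone (y : X × X →₀ Op H) :
    ∃ (s : Finset X) (r : ℝ), (∑ ξ ∈ s, Finsupp.single (ξ, ξ) (r • (1 : Op H))) + y ∈
      nonnegCone H X := by
  obtain ⟨s, hs⟩ := exists_support_subset y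
  refine ⟨s, ∑ i : s, ∑ j : s, ‖y (i, j)‖, fun v => ?_⟩
  set r := ∑ i : s, ∑ j : s, ‖y (i, j)‖
  have h1 : quadForm v (∑ ξ ∈ s, Finsupp.single (ξ, ξ) (r • (1 : Op H))) =
      r * ∑ ξ ∈ s, ‖v ξ‖ ^ 2 := by
    rw [map_sum, Finset.mul_sum]
    refine Finset.sum_congr rfl fun ξ _ => ?_
    rw [quadForm_single, smul_apply, one_apply_eq_self, real_inner_smul_left,
      real_inner_self_eq_norm_sq]
  have hle : ∀ i : s, ‖v i‖ ^ 2 ≤ ∑ ξ ∈ s, ‖v ξ‖ ^ 2 := fun i =>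
    Finset.single_le_sum (f := fun ξ => ‖v ξ‖ ^ 2) (fun _ _ => sq_nonneg _) i.2
  have h2 : -(r * ∑ ξ ∈ s, ‖v ξ‖ ^ 2) ≤ quadForm v y := by
    rw [quadForm, lsum_eq_sum_coe _ _ hs, Finset.sum_mul, ← Finset.sum_neg_distrib]
    refine Finset.sum_le_sum fun i _ => ?_
    rw [Finset.sum_mul, ← Finset.sum_neg_distrib]
    refine Finset.sum_le_sum fun j _ => ?_
    rw [matrixCoeff_apply]
    refine neg_le_of_abs_le ((abs_real_inner_le_norm _ _).trans ?_)
    calc ‖y (i, j) (v j)‖ * ‖v i‖ ≤ ‖y (i, j)‖ * ‖v j‖ * ‖v i‖ := by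
          gcongr
          exact ContinuousLinearMap.le_opNorm _ _
      _ ≤ ‖y (i, j)‖ * ∑ ξ ∈ s, ‖v ξ‖ ^ 2 := by
          rw [mul_assoc]
          gcongr
          nlinarith [hle i, hle j, sq_nonneg (‖v j‖ - ‖v i‖)]
  rw [map_add, h1]
  linarith

/-- The functional `y ↦ ∑ ⟪π (y (ξ, η)) η, ξ⟫` on matrices over `V`. -/
def pairing (π : V →ₗ[ℝ] Op L) : (L × L →₀ V) →ₗ[ℝ] ℝ :=
  Finsupp.lsum ℝ fun p => matrixCoeff p.2 p.1 ∘ₗ π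

theorem pairing_single (π : V →ₗ[ℝ] Op L) (ξ η : L) (v : V) :
    pairing π (Finsupp.single (ξ, η) v) = ⟪π v η, ξ⟫_ℝ := by
  simp [pairing, matrixCoeff_apply]

variable [CompleteSpace H₀] [CompleteSpace H] [CompleteSpace L]

/-- A completely positive kernel over `L` on a subspace `A` of `B(H)`, in the form of the
functionals `S ξ η = ⟪ρ(·) η, ξ⟫` of a ucp map `ρ : A → B(L)`. -/
structure IsCPKernel (A : Submodule ℝ (Op H)) (S : L → L → A →ₗ[ℝ] ℝ) : Prop where
  symm : ∀ ξ η (a b : A), (b : Op H) = star (a : Op H) → S ξ η b = S η ξ a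
  one : ∀ ξ η (a : A), (a : Op H) = 1 → S ξ η a = ⟪ξ, η⟫_ℝ
  nonneg : ∀ {ι : Type u} [Fintype ι] (ξ : ι → L) (a : ι → ι → A),
    PosMat (fun i j => (a i j : Op H)) → 0 ≤ ∑ i, ∑ j, S (ξ i) (ξ j) (a i j)

theorem sum_inner_selfAdjoint_part {ι : Type*} [Fintype ι] (b : ι → ι → Op H) (v : ι → H) :
    ∑ i, ∑ j, ⟪((2⁻¹ : ℝ) • (b i j + star (b j i))) (v j), v i⟫_ℝ =
      ∑ i, ∑ j, ⟪b i j (v j), v i⟫_ℝ := by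
  have h : ∑ i, ∑ j, ⟪star (b j i) (v j), v i⟫_ℝ = ∑ i, ∑ j, ⟪b i j (v j), v i⟫_ℝ := by
    rw [Finset.sum_comm]
    refine Finset.sum_congr rfl fun i _ => Finset.sum_congr rfl fun j _ => ?_
    rw [ContinuousLinearMap.star_eq_adjoint, ContinuousLinearMap.adjoint_inner_left,
      real_inner_comm]
  simp only [smul_apply, add_apply, real_inner_smul_left, inner_add_left, ← Finset.mul_sum,
    Finset.sum_add_distrib, h]
  ring

theorem pairing_nonneg (hV : IsOperatorSystem V) {π : V →ₗ[ℝ] Op L} (hπ : IsUCP V π)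
    {j : V →ₗ[ℝ] Op H} (hj : IsUCOE V j) {x : L × L →₀ V}
    (hx : Finsupp.mapRange.linearMap j x ∈ nonnegCone H L) : 0 ≤ pairing π x := by
  classical
  obtain ⟨s, hs⟩ := exists_support_subset x
  have hs' : (Finsupp.mapRange.linearMap j x).support ⊆ s ×ˢ s :=
    (Finsupp.support_mapRange (hf := map_zero j)).trans hs
  let st : V → V := fun v => ⟨star (v : Op H₀), hV.star_mem _ v.2⟩
  -- The self-adjoint part of `x`, which has the same quadratic forms as `x`.
  let a : s → s → V := fun ξ η => (2⁻¹ : ℝ) • (x (ξ, η) + st (x (η, ξ)))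
  have hja : ∀ ξ η, j (a ξ η) = (2⁻¹ : ℝ) • (j (x (ξ, η)) + star (j (x (η, ξ)))) := fun ξ η => by
    rw [map_smul, map_add, ← hj.ucp.map_star hV (w := st (x (η, ξ))) rfl]
  have hπa : ∀ ξ η, π (a ξ η) = (2⁻¹ : ℝ) • (π (x (ξ, η)) + star (π (x (η, ξ)))) := fun ξ η => by
    rw [map_smul, map_add, ← hπ.map_star hV (w := st (x (η, ξ))) rfl]
  have hpos : PosMat fun ξ η => j (a ξ η) := by
    refine ⟨fun ξ η u w => ?_, fun v => ?_⟩
    · have : j (a ξ η) = star (j (a η ξ)) := by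
        rw [hja, hja, star_smul, star_add, star_star, add_comm]
        simp
      change ⟪j (a ξ η) u, w⟫_ℝ = _
      rw [this, ContinuousLinearMap.star_eq_adjoint, ContinuousLinearMap.adjoint_inner_left]
    · let w : L → H := fun ξ => if h : ξ ∈ s then v ⟨ξ, h⟩ else 0
      have hw : ∀ ξ : s, w ξ = v ξ := fun ξ => dif_pos ξ.2
      have h := hx w
      rw [quadForm, lsum_eq_sum_coe _ _ hs'] at h
      simp only [hja]
      rw [sum_inner_selfAdjoint_part (fun ξ η : s => j (x (ξ, η)))]
      simpa [matrixCoeff_apply, hw] using h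
  have h := (hπ.posMat (hj.posMat_of_map hpos)).2 fun ξ => ξ.1
  simp only [hπa] at h
  rw [sum_inner_selfAdjoint_part (fun ξ η : s => π (x (ξ, η)))] at h
  rw [pairing, lsum_eq_sum_coe _ _ hs]
  exact h

/-- A real version of Arveson's extension theorem: M. Riesz' extension theorem extends the
functional associated with `π` from the matrices over `j(V)` to all matrices over `B(H)`. -/
theorem exists_cpKernel_extension (hV : IsOperatorSystem V) {π : V →ₗ[ℝ] Op L} (hπ : IsUCP V π)
    {j : V →ₗ[ℝ] Op H} (hj : IsUCOE V j) (A : Submodule ℝ (Op H)) :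
    ∃ S : L → L → A →ₗ[ℝ] ℝ, IsCPKernel.{u} A S ∧
      ∀ ξ η (v : V) (a : A), (a : Op H) = j v → S ξ η a = ⟪π v η, ξ⟫_ℝ := by
  let J : (L × L →₀ V) →ₗ[ℝ] (L × L →₀ Op H) := Finsupp.mapRange.linearMap j
  have hJ : Function.Injective J := Finsupp.mapRange_injective j (map_zero j) hj.injective
  let e := LinearEquiv.ofInjective J hJ
  let f : (L × L →₀ Op H) →ₗ.[ℝ] ℝ := ⟨LinearMap.range J, pairing π ∘ₗ e.symm.toLinearMap⟩
  have hf : ∀ x (hx : J x ∈ f.domain), f ⟨J x, hx⟩ = pairing π x := by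
    intro x hx
    change pairing π (e.symm ⟨J x, hx⟩) = _
    congr 1
    exact e.symm_apply_eq.2 (Subtype.ext rfl)
  obtain ⟨g, hgf, hg⟩ := riesz_extension (nonnegCone H L) f (by
      rintro ⟨_, x, rfl⟩ hx
      exact (pairing_nonneg hV hπ hj hx).trans_eq (hf x _).symm) (fun y => by
      obtain ⟨s, r, h⟩ := exists_add_mem_nonnegCone y
      refine ⟨⟨_, LinearMap.mem_range_self J
        (∑ ξ ∈ s, Finsupp.single (ξ, ξ) (r • ⟨1, hV.one_mem⟩))⟩, ?_⟩
      change J _ + y ∈ _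
      convert h using 2
      rw [map_sum]
      refine Finset.sum_congr rfl fun ξ _ => ?_
      rw [Finsupp.mapRange.linearMap_apply, Finsupp.mapRange_single, map_smul,
        hj.ucp.unital _ rfl])
  have hgj : ∀ ξ η v, g (Finsupp.single (ξ, η) (j v)) = ⟪π v η, ξ⟫_ℝ := by
    intro ξ η v
    have h1 : J (Finsupp.single (ξ, η) v) = Finsupp.single (ξ, η) (j v) := by
      rw [Finsupp.mapRange.linearMap_apply, Finsupp.mapRange_single]
    rw [← h1, ← pairing_single]
    exact (hgf ⟨_, LinearMap.mem_range_self J _⟩).trans (hf _ _)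
  refine ⟨fun ξ η => g ∘ₗ Finsupp.lsingle (ξ, η) ∘ₗ A.subtype, ⟨fun ξ η a b hab => ?_,
    fun ξ η a ha => ?_, fun ξ a ha => ?_⟩, fun ξ η v a ha => ?_⟩
  · change g (Finsupp.single (ξ, η) b.1) = g (Finsupp.single (η, ξ) a.1)
    rw [hab]
    -- The difference is skew-adjoint, so both it and its negative lie in the cone.
    have h : ∀ v : L → H, quadForm v
        (Finsupp.single (ξ, η) (star a.1) - Finsupp.single (η, ξ) a.1) = 0 := fun v => by
      rw [map_sub, quadForm_single, quadForm_single, ContinuousLinearMap.star_eq_adjoint,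
        ContinuousLinearMap.adjoint_inner_left, real_inner_comm, sub_self]
    have h1 := hg _ (mem_nonnegCone.2 fun v => (h v).ge)
    have h2 := hg _ (mem_nonnegCone.2 fun v => (by rw [map_neg, h v, neg_zero] :
      quadForm v (-(Finsupp.single (ξ, η) (star a.1) - Finsupp.single (η, ξ) a.1)) = 0).ge)
    rw [map_neg] at h2
    rw [map_sub] at h1 h2
    linarith
  · change g (Finsupp.single (ξ, η) a.1) = _
    have := hgj ξ η ⟨1, hV.one_mem⟩
    rw [hj.ucp.unital _ rfl, hπ.unital _ rfl] at this
    rw [ha, this, one_apply_eq_self, real_inner_comm]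
  · change 0 ≤ ∑ i, ∑ l, g (Finsupp.single (ξ i, ξ l) (a i l).1)
    simp only [← map_sum]
    refine hg _ (mem_nonnegCone.2 fun v => ?_)
    simp only [map_sum, quadForm_single]
    exact ha.2 fun i => v (ξ i)
  · change g (Finsupp.single (ξ, η) a.1) = _
    rw [ha, hgj]

theorem IsUCP.isCPKernel {A : Submodule ℝ (Op H)} (hA : IsOperatorSystem A) {ρ : A →ₗ[ℝ] Op L}
    (hρ : IsUCP A ρ) : IsCPKernel.{u} A fun ξ η : L => matrixCoeff η ξ ∘ₗ ρ where
  symm ξ η a b hab := by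
    change ⟪ρ b η, ξ⟫_ℝ = ⟪ρ a ξ, η⟫_ℝ
    rw [hρ.map_star hA hab, ContinuousLinearMap.star_eq_adjoint,
      ContinuousLinearMap.adjoint_inner_left, real_inner_comm]
  one ξ η a ha := by
    change ⟪ρ a η, ξ⟫_ℝ = _
    rw [hρ.unital a ha, one_apply_eq_self, real_inner_comm]
  nonneg ξ a ha := (hρ.posMat ha).2 ξ

end Extension

/-! ### The GNS representation of a completely positive kernel -/

section GNS

/-- The Hilbert space completion of a vector space with a positive semidefinite form. -/
theorem exists_hilbertSpace_of_form {G : Type u} [AddCommGroup G] [Module ℝ G]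
    (B : G →ₗ[ℝ] G →ₗ[ℝ] ℝ) (hsymm : ∀ x y, B x y = B y x) (hpos : ∀ x, 0 ≤ B x x) :
    ∃ (L' : Type u) (_ : NormedAddCommGroup L') (_ : InnerProductSpace ℝ L')
      (_ : CompleteSpace L') (q : G →ₗ[ℝ] L'), DenseRange q ∧ ∀ x y, ⟪q x, q y⟫_ℝ = B x y := by
  let core : PreInnerProductSpace.Core ℝ G :=
    { inner := fun x y => B x y
      conj_inner_symm := fun x y => hsymm y x
      re_inner_nonneg := fun x => hpos x
      add_left := fun x y z => by simp
      smul_left := fun x y r => by simp }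
  let : SeminormedAddCommGroup G :=
    InnerProductSpace.Core.toSeminormedAddCommGroup (𝕜 := ℝ) (c := core)
  let : InnerProductSpace ℝ G := InnerProductSpace.ofCore core
  exact ⟨UniformSpace.Completion G, inferInstance, inferInstance, inferInstance,
    (UniformSpace.Completion.toComplₗᵢ (𝕜 := ℝ) (E := G)).toLinearMap,
    UniformSpace.Completion.denseRange_coe, fun x y => UniformSpace.Completion.inner_coe x y⟩

variable {H : Type u} [NormedAddCommGroup H] [InnerProductSpace ℝ H] [CompleteSpace H]
  {X : Type*}

theorem PosMat.conj {ι τ : Type*} [Fintype ι] [Fintype τ] {a : ι → ι → Op H} (ha : PosMat a)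
    (c : ι → τ → Op H) :
    PosMat fun p q : ι × τ => star (c p.1 p.2) * a p.1 q.1 * c q.1 q.2 := by
  have key : ∀ (p q : ι × τ) (u w : H), ⟪(star (c p.1 p.2) * a p.1 q.1 * c q.1 q.2) u, w⟫_ℝ =
      ⟪a p.1 q.1 (c q.1 q.2 u), c p.1 p.2 w⟫_ℝ := fun p q u w => by
    rw [mul_apply_eq_comp, mul_apply_eq_comp, ContinuousLinearMap.star_eq_adjoint,
      ContinuousLinearMap.adjoint_inner_left]
  refine ⟨fun p q u w => ?_, fun v => ?_⟩
  · rw [key, real_inner_comm _ u, key, ha.1, real_inner_comm]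
  · have h := ha.2 fun i => ∑ t, c i t (v (i, t))
    simp only [key, Fintype.sum_prod_type]
    refine h.trans_eq (Finset.sum_congr rfl fun i _ => ?_)
    simp only [map_sum, sum_inner, inner_sum]
    rw [Finset.sum_comm (s := (Finset.univ : Finset τ))]

variable (A : StarSubalgebra ℝ (Op H))

/-- The identification of a `*`-subalgebra with its underlying subspace. -/
def toSub : A →ₗ[ℝ] A.toSubalgebra.toSubmodule where
  toFun a := ⟨a.1, a.2⟩
  map_add' _ _ := rfl
  map_smul' _ _ := rfl

variable {A}

/-- The GNS form `∑ T ξ η ((x ξ)* (y η))` on the formal sums `∑ x ξ ⊗ ξ`. -/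
def gnsForm (T : X → X → A →ₗ[ℝ] ℝ) : (X →₀ A) →ₗ[ℝ] (X →₀ A) →ₗ[ℝ] ℝ :=
  Finsupp.lsum ℝ fun ξ => LinearMap.flip <| Finsupp.lsum ℝ fun η => LinearMap.flip <|
    LinearMap.mk₂ ℝ (fun b c : A => T ξ η (star b * c)) (by simp [add_mul]) (by simp)
      (by simp [mul_add]) (by simp)

theorem gnsForm_eq_sum (T : X → X → A →ₗ[ℝ] ℝ) (x y : X →₀ A) {s : Finset X}
    (hx : x.support ⊆ s) (hy : y.support ⊆ s) :
    gnsForm T x y = ∑ ξ : s, ∑ η : s, T ξ η (star (x ξ) * y η) := by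
  rw [gnsForm, Finsupp.lsum_apply, Finsupp.sum_of_support_subset _ hx _ (by simp),
    LinearMap.sum_apply, ← Finset.sum_coe_sort s]
  refine Finset.sum_congr rfl fun ξ _ => ?_
  rw [LinearMap.flip_apply, Finsupp.lsum_apply, Finsupp.sum_of_support_subset _ hy _ (by simp),
    LinearMap.sum_apply, ← Finset.sum_coe_sort s]
  rfl

/-- Left multiplication by `a` on formal sums. -/
def leftMul (a : A) : (X →₀ A) →ₗ[ℝ] (X →₀ A) :=
  Finsupp.mapRange.linearMap (LinearMap.mulLeft ℝ a)

theorem leftMul_apply (a : A) (x : X →₀ A) (ξ : X) : leftMul a x ξ = a * x ξ := by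
  simp [leftMul]

theorem support_leftMul (a : A) (x : X →₀ A) : (leftMul a x).support ⊆ x.support :=
  Finsupp.support_mapRange (hf := mul_zero a)

theorem gnsForm_leftMul_left (T : X → X → A →ₗ[ℝ] ℝ) (a : A) (x y : X →₀ A) :
    gnsForm T (leftMul a x) y = gnsForm T x (leftMul (star a) y) := by
  classical
  have hx : x.support ⊆ x.support ∪ y.support := Finset.subset_union_left
  have hy : y.support ⊆ x.support ∪ y.support := Finset.subset_union_right
  rw [gnsForm_eq_sum T _ _ ((support_leftMul a x).trans hx) hy,
    gnsForm_eq_sum T _ _ hx ((support_leftMul (star a) y).trans hy)]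
  simp only [leftMul_apply, star_mul, mul_assoc]

theorem posMat_norm_sq_sub (a : Op H) :
    PosMat fun _ _ : Fin 1 => ‖a‖ ^ 2 • (1 : Op H) - star a * a := by
  refine ⟨fun _ _ u w => ?_, fun v => ?_⟩
  · simp [inner_sub_left, inner_sub_right, real_inner_smul_left, real_inner_smul_right,
      ContinuousLinearMap.star_eq_adjoint, ContinuousLinearMap.adjoint_inner_left,
      ContinuousLinearMap.adjoint_inner_right]
  · simp only [Finset.univ_unique, Finset.sum_singleton, sub_apply, smul_apply,
      one_apply_eq_self, inner_sub_left, real_inner_smul_left, mul_apply_eq_comp,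
      ContinuousLinearMap.star_eq_adjoint, ContinuousLinearMap.adjoint_inner_left,
      real_inner_self_eq_norm_sq, sub_nonneg, ← mul_pow]
    exact pow_le_pow_left₀ (norm_nonneg _) (a.le_opNorm _) 2

theorem posMat_one {E : Type*} [NormedAddCommGroup E] [InnerProductSpace ℝ E] :
    PosMat fun _ _ : Fin 1 => (1 : Op E) :=
  ⟨fun _ _ _ _ => by simp, fun v => by simp⟩

/-- A linear map on `G` that is bounded for the seminorm `‖q ·‖` induces a bounded operator. -/
theorem exists_op_of_bound {G E : Type*} [AddCommGroup G] [Module ℝ G] [NormedAddCommGroup E]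
    [InnerProductSpace ℝ E] [CompleteSpace E] {q : G →ₗ[ℝ] E} (hq : DenseRange q)
    (f : G →ₗ[ℝ] G) {C : ℝ} (hC : 0 ≤ C) (h : ∀ x, ‖q (f x)‖ ≤ C * ‖q x‖) :
    ∃ T : Op E, (∀ x, T (q x) = q (f x)) ∧ ‖T‖ ≤ C :=
  ⟨(q ∘ₗ f).extendOfNorm q, fun x => LinearMap.extendOfNorm_eq hq ⟨C, h⟩ x,
    LinearMap.opNorm_extendOfNorm_le hq hC h⟩

theorem _root_.DenseRange.ext_op {G E : Type*} [NormedAddCommGroup E] [InnerProductSpace ℝ E]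
    {q : G → E} (hq : DenseRange q) {T T' : Op E} (h : ∀ x, T (q x) = T' (q x)) : T = T' :=
  DFunLike.coe_injective (hq.equalizer T.continuous T'.continuous (funext h))

theorem _root_.DenseRange.sum_inner_nonneg {G E ι : Type*} [NormedAddCommGroup E]
    [InnerProductSpace ℝ E] [Fintype ι] {q : G → E} (hq : DenseRange q) (T : ι → ι → Op E)
    (h : ∀ x : ι → G, 0 ≤ ∑ i, ∑ j, ⟪T i j (q (x j)), q (x i)⟫_ℝ) (v : ι → E) :
    0 ≤ ∑ i, ∑ j, ⟪T i j (v j), v i⟫_ℝ := by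
  have hc : IsClosed {v : ι → E | 0 ≤ ∑ i, ∑ j, ⟪T i j (v j), v i⟫_ℝ} :=
    isClosed_le continuous_const (by fun_prop)
  have hd : DenseRange (Pi.map fun _ : ι => q) := DenseRange.piMap fun _ => hq
  exact hd.induction_on (p := fun v => 0 ≤ ∑ i, ∑ j, ⟪T i j (v j), v i⟫_ℝ) v hc h

variable {L : Type u} [NormedAddCommGroup L] [InnerProductSpace ℝ L]
  {S : L → L → A.toSubalgebra.toSubmodule →ₗ[ℝ] ℝ}

/-- Left multiplication is completely positive for the GNS form. -/
theorem IsCPKernel.gnsForm_nonneg (hS : IsCPKernel.{u} _ S) {ι : Type} [Fintype ι]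
    {a : ι → ι → A} (ha : PosMat fun i j => (a i j : Op H)) (v : ι → L →₀ A) :
    0 ≤ ∑ i, ∑ j, gnsForm (fun ξ η => S ξ η ∘ₗ toSub A) (v i) (leftMul (a i j) (v j)) := by
  classical
  let s : Finset L := Finset.univ.biUnion fun i => (v i).support
  have hs : ∀ i, (v i).support ⊆ s := fun i =>
    Finset.subset_biUnion_of_mem (fun i => (v i).support) (Finset.mem_univ i)
  have h := hS.nonneg (ι := ι × s) (fun p => p.2.1)
    (fun p q => toSub A (star (v p.1 p.2) * a p.1 q.1 * v q.1 q.2))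
    (ha.conj fun i (ξ : s) => (v i ξ : Op H))
  refine h.trans_eq ?_
  simp only [Fintype.sum_prod_type]
  refine Finset.sum_congr rfl fun i _ => ?_
  rw [Finset.sum_comm]
  refine Finset.sum_congr rfl fun j _ => ?_
  rw [gnsForm_eq_sum _ _ _ (hs i) ((support_leftMul _ _).trans (hs j))]
  simp only [leftMul_apply, mul_assoc, LinearMap.comp_apply]

theorem IsCPKernel.gnsForm_symm (hS : IsCPKernel.{u} _ S) (x y : L →₀ A) :
    gnsForm (fun ξ η => S ξ η ∘ₗ toSub A) x y = gnsForm (fun ξ η => S ξ η ∘ₗ toSub A) y x := by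
  classical
  have hx : x.support ⊆ x.support ∪ y.support := Finset.subset_union_left
  have hy : y.support ⊆ x.support ∪ y.support := Finset.subset_union_right
  rw [gnsForm_eq_sum _ _ _ hx hy, gnsForm_eq_sum _ _ _ hy hx, Finset.sum_comm]
  refine Finset.sum_congr rfl fun ξ _ => Finset.sum_congr rfl fun η _ => ?_
  refine hS.symm _ _ _ _ ?_
  change ((star (x η) * y ξ : A) : Op H) = star ((star (y ξ) * x η : A) : Op H)
  simp

theorem leftMul_one (x : X →₀ A) : leftMul 1 x = x := by
  ext1 ξ
  rw [leftMul_apply, one_mul]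

theorem IsCPKernel.gnsForm_self_nonneg (hS : IsCPKernel.{u} _ S) (x : L →₀ A) :
    0 ≤ gnsForm (fun ξ η => S ξ η ∘ₗ toSub A) x x := by
  have := hS.gnsForm_nonneg (a := fun _ _ : Fin 1 => (1 : A)) posMat_one fun _ => x
  simpa only [Finset.univ_unique, Finset.sum_singleton, leftMul_one] using this

/-- The element `‖a‖² - a* a` is positive, so left multiplication by `a` is bounded by `‖a‖` for the
GNS form. -/
theorem IsCPKernel.gnsForm_leftMul_le (hS : IsCPKernel.{u} _ S) (a : A) (x : L →₀ A) :
    gnsForm (fun ξ η => S ξ η ∘ₗ toSub A) (leftMul a x) (leftMul a x) ≤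
      ‖a‖ ^ 2 * gnsForm (fun ξ η => S ξ η ∘ₗ toSub A) x x := by
  have := hS.gnsForm_nonneg (a := fun _ _ : Fin 1 => ‖a‖ ^ 2 • (1 : A) - star a * a)
    (posMat_norm_sq_sub (a : Op H)) fun _ => x
  have e : leftMul (‖a‖ ^ 2 • (1 : A) - star a * a) x =
      ‖a‖ ^ 2 • x - leftMul (star a) (leftMul a x) := by
    ext1 ξ
    simp [leftMul_apply, sub_mul, mul_assoc]
  simp only [Finset.univ_unique, Finset.sum_singleton, e, map_sub, map_smul, smul_eq_mul] at this
  rw [gnsForm_leftMul_left]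
  linarith

/-- The representation of `A` by left multiplication on the completion of the formal sums
`∑ x ξ ⊗ ξ` with respect to the GNS form. -/
theorem IsCPKernel.exists_leftRegular (hS : IsCPKernel.{u} _ S) :
    ∃ (L' : Type u) (_ : NormedAddCommGroup L') (_ : InnerProductSpace ℝ L')
      (_ : CompleteSpace L') (q : (L →₀ A) →ₗ[ℝ] L') (σ : A →ₗ[ℝ] Op L'), DenseRange q ∧
      (∀ x y, ⟪q x, q y⟫_ℝ = gnsForm (fun ξ η => S ξ η ∘ₗ toSub A) x y) ∧
      (∀ a x, σ a (q x) = q (leftMul a x)) ∧ ∀ a, ‖σ a‖ ≤ ‖a‖ := by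
  obtain ⟨L', i1, i2, i3, q, hq, hqB⟩ :=
    exists_hilbertSpace_of_form _ hS.gnsForm_symm hS.gnsForm_self_nonneg
  have hqnorm : ∀ a x, ‖q (leftMul a x)‖ ≤ ‖a‖ * ‖q x‖ := fun a x => by
    refine (pow_le_pow_iff_left₀ (norm_nonneg _) (by positivity) two_ne_zero).1 ?_
    rw [mul_pow, ← real_inner_self_eq_norm_sq (q (leftMul a x)),
      ← real_inner_self_eq_norm_sq (q x), hqB, hqB]
    exact hS.gnsForm_leftMul_le a x
  choose σ hσ hσn using fun a => exists_op_of_bound hq (leftMul a) (norm_nonneg a) (hqnorm a)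
  refine ⟨L', i1, i2, i3, q,
    { toFun := σ
      map_add' := fun a b => hq.ext_op fun x => ?_
      map_smul' := fun c a => hq.ext_op fun x => ?_ }, hq, hqB, hσ, hσn⟩
  · rw [add_apply, hσ, hσ, hσ, ← map_add]
    congr 1
    ext1 ξ
    rw [leftMul_apply, Finsupp.add_apply, leftMul_apply, leftMul_apply, add_mul]
  · rw [RingHom.id_apply, smul_apply, hσ, hσ, ← map_smul]
    congr 1
    ext1 ξ
    rw [leftMul_apply, Finsupp.smul_apply, leftMul_apply, smul_mul_assoc]

theorem gnsForm_single_leftMul_single (T : X → X → A →ₗ[ℝ] ℝ) (ξ η : X) (a : A) :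
    gnsForm T (Finsupp.single ξ 1) (leftMul a (Finsupp.single η 1)) = T ξ η a := by
  simp [gnsForm, leftMul]

/-- The isometry associated with a family of vectors `f ξ` that reproduces the inner products. -/
theorem exists_linearIsometry_of_inner {E F : Type*} [NormedAddCommGroup E]
    [InnerProductSpace ℝ E] [NormedAddCommGroup F] [InnerProductSpace ℝ F] (f : E → F)
    (h : ∀ ξ η, ⟪f ξ, f η⟫_ℝ = ⟪ξ, η⟫_ℝ) : ∃ α : E →ₗᵢ[ℝ] F, ∀ ξ, α ξ = f ξ := by
  let α : E →ₗ[ℝ] F :=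
    { toFun := f
      map_add' := fun ξ η => by
        rw [← sub_eq_zero, ← inner_self_eq_zero (𝕜 := ℝ)]
        simp only [inner_sub_left, inner_sub_right, inner_add_left, inner_add_right, h]
        ring
      map_smul' := fun c ξ => by
        rw [← sub_eq_zero, ← inner_self_eq_zero (𝕜 := ℝ)]
        simp only [inner_sub_left, inner_sub_right, real_inner_smul_left, real_inner_smul_right,
          h, RingHom.id_apply]
        ring }
  exact ⟨α.isometryOfInner h, fun _ => rfl⟩

/-- The GNS construction for a completely positive kernel `S`: a representation `σ` of `A` with an
isometry `α` such that `S ξ η = ⟪σ(·) (α η), α ξ⟫`. -/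
theorem IsCPKernel.exists_gns (hS : IsCPKernel.{u} _ S) :
    ∃ (L' : Type u) (_ : NormedAddCommGroup L') (_ : InnerProductSpace ℝ L')
      (_ : CompleteSpace L') (σ : A →ₗ[ℝ] Op L') (α : L →ₗᵢ[ℝ] L'),
      (∀ a b, σ (a * b) = σ a * σ b) ∧ σ 1 = 1 ∧ (∀ a, σ (star a) = star (σ a)) ∧
      (∀ a, ‖σ a‖ ≤ ‖a‖) ∧ (∀ a ξ η, ⟪σ a (α η), α ξ⟫_ℝ = S ξ η (toSub A a)) ∧
      ∀ (k : ℕ) (a : Fin k → Fin k → A), PosMat (fun i j => (a i j : Op H)) →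
        PosMat fun i j => σ (a i j) := by
  obtain ⟨L', i1, i2, i3, q, σ, hq, hqB, hσ, hσn⟩ := hS.exists_leftRegular
  have hstar : ∀ a, σ (star a) = star (σ a) := fun a => by
    rw [ContinuousLinearMap.star_eq_adjoint]
    refine hq.ext_op fun x => ext_inner_right ℝ fun w => ?_
    refine hq.induction_on (p := fun w => ⟪σ (star a) (q x), w⟫_ℝ =
      ⟪ContinuousLinearMap.adjoint (σ a) (q x), w⟫_ℝ) w
      (isClosed_eq (by fun_prop) (by fun_prop)) fun y => ?_
    rw [ContinuousLinearMap.adjoint_inner_left, hσ, hσ, hqB, hqB, gnsForm_leftMul_left,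
      star_star]
  have hcoeff : ∀ a ξ η, ⟪σ a (q (Finsupp.single η 1)), q (Finsupp.single ξ 1)⟫_ℝ =
      S ξ η (toSub A a) := fun a ξ η => by
    rw [hσ, hqB, hS.gnsForm_symm, gnsForm_single_leftMul_single, LinearMap.comp_apply]
  have hinner : ∀ ξ η, ⟪q (Finsupp.single ξ 1), q (Finsupp.single η 1)⟫_ℝ = ⟪ξ, η⟫_ℝ :=
    fun ξ η => by
    rw [← leftMul_one (Finsupp.single ξ 1), ← hσ, hcoeff, hS.one _ _ _ rfl, real_inner_comm]
  obtain ⟨α, hα⟩ := exists_linearIsometry_of_inner _ hinner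
  refine ⟨L', i1, i2, i3, σ, α, fun a b => hq.ext_op fun x => ?_,
    hq.ext_op fun x => ?_, hstar, hσn, fun a ξ η => by rw [hα, hα, hcoeff],
    fun k a ha => ⟨fun i j u w => ?_, hq.sum_inner_nonneg _ fun x => ?_⟩⟩
  · rw [mul_apply_eq_comp, hσ, hσ, hσ]
    congr 1
    ext1 ξ
    rw [leftMul_apply, leftMul_apply, leftMul_apply, mul_assoc]
  · rw [hσ, leftMul_one, one_apply_eq_self]
  · have : a j i = star (a i j) := Subtype.ext <| by
      rw [StarMemClass.coe_star, ContinuousLinearMap.star_eq_adjoint,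
        ContinuousLinearMap.eq_adjoint_iff]
      exact fun x y => (ha.1 j i x y)
    change ⟪σ (a i j) u, w⟫_ℝ = ⟪u, σ (a j i) w⟫_ℝ
    rw [this, hstar, ContinuousLinearMap.star_eq_adjoint, ContinuousLinearMap.adjoint_inner_right]
  · simp only [hσ, hqB]
    refine (hS.gnsForm_nonneg ha x).trans_eq ?_
    exact Finset.sum_congr rfl fun i _ => Finset.sum_congr rfl fun j _ => hS.gnsForm_symm _ _

end GNS

/-! ### The unique extension property of maximal maps -/

section UEP

variable {H₀ : Type*} [NormedAddCommGroup H₀] [InnerProductSpace ℝ H₀]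
  {H L : Type u} [NormedAddCommGroup H] [InnerProductSpace ℝ H] [CompleteSpace H]
  [NormedAddCommGroup L] [InnerProductSpace ℝ L] [CompleteSpace L]
  {V : Submodule ℝ (Op H₀)}

/-- The real C*-algebra generated by `s`, as a `*`-subalgebra; the set `cstarGenerated j` is its
underlying subspace for `s = Set.range j`. -/
def genAlg (s : Set (Op H)) : StarSubalgebra ℝ (Op H) := (StarAlgebra.adjoin ℝ s).topologicalClosure

theorem subset_genAlg (s : Set (Op H)) : s ⊆ genAlg s :=
  (StarAlgebra.subset_adjoin ℝ s).trans (StarSubalgebra.le_topologicalClosure _)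

/-- Induction on the generated C*-algebra, for closed properties. -/
theorem genAlg_induction {s : Set (Op H)} {p : genAlg s → Prop} (hp : IsClosed {a | p a})
    (mem : ∀ x (hx : x ∈ s), p ⟨x, subset_genAlg s hx⟩)
    (hone : ∀ r : ℝ, p (r • 1)) (hadd : ∀ a b, p a → p b → p (a + b))
    (hmul : ∀ a b, p a → p b → p (a * b)) (hstar : ∀ a, p a → p (star a)) (a : genAlg s) :
    p a := by
  have hle : (StarAlgebra.adjoin ℝ s : Set (Op H)) ⊆ genAlg s :=
    StarSubalgebra.le_topologicalClosure (StarAlgebra.adjoin ℝ s)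
  have key : ∀ x ∈ StarAlgebra.adjoin ℝ s, ∃ h : x ∈ genAlg s, p ⟨x, h⟩ := fun x hx => by
    induction hx using StarAlgebra.adjoin_induction with
    | mem x h => exact ⟨subset_genAlg s h, mem x h⟩
    | algebraMap r =>
      rw [Algebra.algebraMap_eq_smul_one]
      exact ⟨_, hone r⟩
    | add x y _ _ h1 h2 =>
      obtain ⟨h1, h1'⟩ := h1
      obtain ⟨h2, h2'⟩ := h2
      exact ⟨add_mem h1 h2, hadd ⟨x, h1⟩ ⟨y, h2⟩ h1' h2'⟩
    | mul x y _ _ h1 h2 =>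
      obtain ⟨h1, h1'⟩ := h1
      obtain ⟨h2, h2'⟩ := h2
      exact ⟨mul_mem h1 h2, hmul ⟨x, h1⟩ ⟨y, h2⟩ h1' h2'⟩
    | star x _ h =>
      obtain ⟨h, h'⟩ := h
      exact ⟨star_mem h, hstar ⟨x, h⟩ h'⟩
  have hd : DenseRange (Set.inclusion hle) :=
    (denseRange_inclusion_iff hle).2 (StarSubalgebra.topologicalClosure_coe _).subset
  exact hd.induction_on a hp fun x => (key x x.2).2

theorem isOperatorSystem_cstarGenerated (j : V →ₗ[ℝ] Op H) :
    IsOperatorSystem (cstarGenerated j) where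
  one_mem := one_mem (genAlg (Set.range j))
  star_mem _ h := star_mem (s := genAlg (Set.range j)) h

/-- Unital contractive `*`-homomorphisms from a `*`-algebra of operators into `B(L)`. -/
structure IsStarHom {A : StarSubalgebra ℝ (Op H)} (σ : A →ₗ[ℝ] Op L) : Prop where
  map_mul : ∀ a b, σ (a * b) = σ a * σ b
  map_one : σ 1 = 1
  map_star : ∀ a, σ (star a) = star (σ a)
  norm_le : ∀ a, ‖σ a‖ ≤ ‖a‖

theorem IsStarHom.continuous {A : StarSubalgebra ℝ (Op H)} {σ : A →ₗ[ℝ] Op L}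
    (hσ : IsStarHom σ) : Continuous σ :=
  AddMonoidHomClass.continuous_of_bound σ 1 fun a => by simpa using hσ.norm_le a

/-- An operator `p = p*` commuting with the images of the generators commutes with the whole
image. -/
theorem IsStarHom.commute {s : Set (Op H)} {σ : genAlg s →ₗ[ℝ] Op L} (hσ : IsStarHom σ) {p : Op L}
    (hp : star p = p) (h : ∀ x (hx : x ∈ s), Commute (σ ⟨x, subset_genAlg s hx⟩) p) :
    ∀ a, Commute (σ a) p := by
  refine genAlg_induction ?_ h (fun r => ?_) (fun a b ha hb => ?_) (fun a b ha hb => ?_)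
    fun a ha => ?_
  · exact isClosed_eq (hσ.continuous.mul continuous_const) (continuous_const.mul hσ.continuous)
  · rw [map_smul, hσ.map_one]
    exact (Commute.one_left _).smul_left r
  · rw [map_add]
    exact ha.add_left hb
  · rw [hσ.map_mul]
    exact ha.mul_left hb
  · rw [hσ.map_star, ← hp]
    exact ha.star_star

/-- A `*`-homomorphism is determined by its values on the generators. -/
theorem IsStarHom.ext {s : Set (Op H)} {ρ ρ' : genAlg s →ₗ[ℝ] Op L} (hρ : IsStarHom ρ)
    (hρ' : IsStarHom ρ')
    (h : ∀ x (hx : x ∈ s), ρ ⟨x, subset_genAlg s hx⟩ = ρ' ⟨x, subset_genAlg s hx⟩) : ρ = ρ' := by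
  refine LinearMap.ext <| genAlg_induction (isClosed_eq hρ.continuous hρ'.continuous) h
    (fun r => ?_) (fun a b ha hb => ?_) (fun a b ha hb => ?_) fun a ha => ?_
  · rw [map_smul, map_smul, hρ.map_one, hρ'.map_one]
  · rw [map_add, map_add, ha, hb]
  · rw [hρ.map_mul, hρ'.map_mul, ha, hb]
  · rw [hρ.map_star, hρ'.map_star, ha]

/-- The compression of a `*`-homomorphism to a reducing subspace. -/
theorem IsStarHom.exists_compression {L' : Type u} [NormedAddCommGroup L']
    [InnerProductSpace ℝ L'] [CompleteSpace L'] {A : StarSubalgebra ℝ (Op H)}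
    {σ : A →ₗ[ℝ] Op L'} (hσ : IsStarHom σ) (α : L →ₗᵢ[ℝ] L')
    (hα : ∀ a, Commute (σ a) (α.toContinuousLinearMap ∘L
      ContinuousLinearMap.adjoint α.toContinuousLinearMap)) :
    ∃ ρ : A →ₗ[ℝ] Op L, IsStarHom ρ ∧ ∀ a η ξ, ⟪ρ a η, ξ⟫_ℝ = ⟪σ a (α η), α ξ⟫_ℝ := by
  let α' := α.toContinuousLinearMap
  let β := ContinuousLinearMap.adjoint α'
  have hβα : ∀ u, β (α u) = u := adjoint_isometry_apply α
  have hcomm : ∀ a w, α (β (σ a w)) = σ a (α (β w)) := fun a w =>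
    (DFunLike.congr_fun (hα a).eq w).symm
  let ρ : A →ₗ[ℝ] Op L :=
    { toFun := fun a => β ∘L σ a ∘L α'
      map_add' := fun a b => by ext; simp
      map_smul' := fun c a => by ext; simp }
  have hρa : ∀ a η, ρ a η = β (σ a (α η)) := fun _ _ => rfl
  have hρ : ∀ a η ξ, ⟪ρ a η, ξ⟫_ℝ = ⟪σ a (α η), α ξ⟫_ℝ := fun a η ξ => by
    rw [hρa]
    exact ContinuousLinearMap.adjoint_inner_left α' ξ (σ a (α η))
  refine ⟨ρ, ⟨fun a b => ContinuousLinearMap.ext fun η => ?_,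
    ContinuousLinearMap.ext fun η => ?_,
    fun a => ContinuousLinearMap.ext fun η => ext_inner_right ℝ fun ξ => ?_,
    fun a => ContinuousLinearMap.opNorm_le_bound _ (norm_nonneg a) fun η => ?_⟩, hρ⟩
  · have h1 : σ (a * b) (α η) = σ a (σ b (α η)) := DFunLike.congr_fun (hσ.map_mul a b) _
    have h2 : α (β (σ b (α η))) = σ b (α η) := (hcomm b _).trans (by rw [hβα])
    rw [mul_apply_eq_comp, hρa, hρa, hρa, h1, h2]
  · change β (σ 1 (α η)) = η
    rw [hσ.map_one, one_apply_eq_self, hβα]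
  · rw [hρ, hσ.map_star, ContinuousLinearMap.star_eq_adjoint, ContinuousLinearMap.star_eq_adjoint,
      ContinuousLinearMap.adjoint_inner_left, ContinuousLinearMap.adjoint_inner_left,
      real_inner_comm, ← hρ, real_inner_comm]
  · rw [hρa]
    refine (norm_adjoint_isometry_le α _).trans (((σ a).le_opNorm (α η)).trans ?_)
    rw [α.norm_map]
    exact mul_le_mul_of_nonneg_right (hσ.norm_le a) (norm_nonneg η)

/-- A completely positive kernel extending a maximal map `π` comes from a `*`-homomorphism: its GNS
representation dilates `π`, and this dilation is trivial by maximality, so that `L` reduces the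
representation and the compression to `L` is multiplicative. -/
theorem IsMaximalUCP.exists_starHom {π : V →ₗ[ℝ] Op L}
    (hπ : IsMaximalUCP V π) {j : V →ₗ[ℝ] Op H} (hj : IsUCOE V j)
    {S : L → L → cstarGenerated j →ₗ[ℝ] ℝ} (hS : IsCPKernel.{u} (cstarGenerated j) S)
    (hSπ : ∀ ξ η (v : V) (a : cstarGenerated j), (a : Op H) = j v → S ξ η a = ⟪π v η, ξ⟫_ℝ) :
    ∃ ρ : genAlg (Set.range j) →ₗ[ℝ] Op L, IsStarHom ρ ∧
      (∀ a ξ η, ⟪ρ a η, ξ⟫_ℝ = S ξ η (toSub (genAlg (Set.range j)) a)) ∧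
      ∀ (k : ℕ) (a : Fin k → Fin k → genAlg (Set.range j)),
        PosMat (fun i l => (a i l : Op H)) → PosMat fun i l => ρ (a i l) := by
  obtain ⟨L', _, _, _, σ, α, hmul, hone, hstar, hnorm, hcoeff, hpos⟩ :=
    IsCPKernel.exists_gns (A := genAlg (Set.range j)) hS
  have hσ : IsStarHom σ := ⟨hmul, hone, hstar, hnorm⟩
  let ψ : V →ₗ[ℝ] Op L' :=
    σ ∘ₗ j.codRestrict (genAlg (Set.range j)).toSubalgebra.toSubmodule
      (fun v => subset_genAlg _ (Set.mem_range_self v))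
  have hψ : IsUCP V ψ := isUCP_of_posMat
    (fun v hv => (congrArg σ (Subtype.ext (hj.ucp.unital v hv))).trans hone)
    fun k a ha => hpos k _ (hj.ucp.posMat ha)
  have hdil : IsDilation α ψ π := isDilation_iff.2 <| eq_compress_of_inner fun v ξ η =>
    ((hcoeff _ η ξ).trans (hSπ η ξ v _ rfl)).symm
  have htriv := hπ.2 L' ψ α hψ hdil
  obtain ⟨ρ, hρ, hρσ⟩ := hσ.exists_compression α <| hσ.commute
    (by rw [ContinuousLinearMap.star_eq_adjoint, ContinuousLinearMap.adjoint_comp,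
      ContinuousLinearMap.adjoint_adjoint]) (by
      rintro _ ⟨v, rfl⟩
      exact htriv v)
  refine ⟨ρ, hρ, fun a ξ η => (hρσ a η ξ).trans (hcoeff a ξ η),
    fun k a ha => ⟨fun i l u w => ?_, fun v => ?_⟩⟩
  · rw [hρσ, (hpos k a ha).1, real_inner_comm _ u, hρσ, real_inner_comm]
  · simpa only [hρσ] using (hpos k a ha).2 fun i => α (v i)

/-- Maximal maps have the unique extension property. Existence and uniqueness follow from the same
argument: every completely positive extension of `π` is a `*`-homomorphism, and it is therefore
determined by its values on `j(V)`. -/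
theorem IsMaximalUCP.hasUEP [CompleteSpace H₀] (hV : IsOperatorSystem V) {π : V →ₗ[ℝ] Op L}
    (hπ : IsMaximalUCP V π) : HasUEP V π := by
  intro H _ _ _ j hj
  obtain ⟨S, hS, hSπ⟩ := exists_cpKernel_extension hV hπ.1 hj (cstarGenerated j)
  obtain ⟨ρ, hρ, hρS, hpos⟩ := hπ.exists_starHom hj hS hSπ
  have hρπ : ∀ (v : V) (a : genAlg (Set.range j)), (a : Op H) = j v → ρ a = π v :=
    fun v a hv => ContinuousLinearMap.ext fun η => ext_inner_right ℝ fun ξ =>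
      (hρS a ξ η).trans (hSπ ξ η v _ hv)
  refine ⟨ρ, isUCP_of_posMat (fun a ha => ?_) hpos, hρπ, fun a b c hc => ?_, fun a b hb => ?_,
    fun ρ' hρ' hρ'π => ?_⟩
  · exact (congrArg ρ (Subtype.ext ha)).trans hρ.map_one
  · exact (congrArg ρ (Subtype.ext hc)).trans (hρ.map_mul a b)
  · exact (congrArg ρ (Subtype.ext hb)).trans (hρ.map_star a)
  · obtain ⟨τ, hτ, hτS, -⟩ :=
      hπ.exists_starHom hj (hρ'.isCPKernel (isOperatorSystem_cstarGenerated j))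
        fun ξ η v a ha => by rw [LinearMap.comp_apply, hρ'π v a ha, matrixCoeff_apply]
    have hτρ' : ∀ a : genAlg (Set.range j), τ a = ρ' (toSub (genAlg (Set.range j)) a) := fun a =>
      ContinuousLinearMap.ext fun η => ext_inner_right ℝ fun ξ => hτS a ξ η
    have hτρ : τ = ρ := hτ.ext hρ <| by
      rintro _ ⟨v, rfl⟩
      rw [hτρ', hρπ v _ rfl]
      exact hρ'π v _ rfl
    exact LinearMap.ext fun a => (hτρ' a).symm.trans (DFunLike.congr_fun hτρ _)

end UEP

end RealNC

end

theorem theorem2p7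
    (H₀ : Type u) [NormedAddCommGroup H₀] [InnerProductSpace ℝ H₀] [CompleteSpace H₀] :
    -- every point of a real compact nc convex set has a maximal dilation
    (∀ (P : Submodule ℝ (RealNC.Op H₀)) (κ : Cardinal.{u}),
      Cardinal.aleph0 ≤ κ →
      (∃ S : Set P, Dense S ∧ Cardinal.mk S ≤ κ) →
      ∀ K : (n : Cardinal.{u}) → Set (P →ₗ[ℝ] RealNC.Op (RealNC.Ell2 n)),
      RealNC.IsCompactNCConvex P κ K →
      ∀ (n : Cardinal.{u}) (x : P →ₗ[ℝ] RealNC.Op (RealNC.Ell2 n)), x ∈ K n →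
        ∃ (m : Cardinal.{u}) (y : P →ₗ[ℝ] RealNC.Op (RealNC.Ell2 m))
          (α : RealNC.Ell2 n →ₗᵢ[ℝ] RealNC.Ell2 m),
          RealNC.IsMaximalPoint K y ∧ RealNC.IsDilation α y x) ∧
    -- every ucp map on a real operator system has a maximal ucp dilation, which has the UEP
    (∀ V : Submodule ℝ (RealNC.Op H₀), RealNC.IsOperatorSystem V →
      ∀ (H : Type u) [NormedAddCommGroup H] [InnerProductSpace ℝ H] [CompleteSpace H]
        (φ : V →ₗ[ℝ] RealNC.Op H), RealNC.IsUCP V φ →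
        ∃ (L : Type u) (_ : NormedAddCommGroup L) (_ : InnerProductSpace ℝ L)
          (_ : CompleteSpace L) (π : V →ₗ[ℝ] RealNC.Op L) (α : H →ₗᵢ[ℝ] L),
          RealNC.IsDilation α π φ ∧ RealNC.IsMaximalUCP V π ∧ RealNC.HasUEP V π) := by
  refine ⟨fun P κ hκ hP K hK n x hx => RealNC.exists_maximalPoint hκ hP hK hx,
    fun V hV H _ _ _ φ hφ => ?_⟩
  obtain ⟨L, i1, i2, i3, π, α, hα, hπ⟩ := RealNC.exists_maximalUCP hV hφ
  exact ⟨L, i1, i2, i3, π, α, hα, hπ, hπ.hasUEP hV⟩
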